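/- **Theorem (toy model, $AJ(\xi_0)\neq 0$).** Let $X$ be the elliptic surface $y^2=x^3+x^2+t$, and put $a=\mathbf i y+x+\tfrac23$, $b=\mathbf i y-x-\tfrac23$. On the open subset of $X$ where $a$, $b$ and $t+\tfrac4{27}$ are invertible consider the rational $K_2$-class (a combination of symbols, with $\mathbb Q$-coefficients, written additively) $$\xi''=\Big\{\tfrac{a^3}{8},\tfrac{b^3}{8}\Big\}+3\Big\{\tfrac{b}{a},-t-\tfrac4{27}\Big\}.$$ Let $\square=\mathbb P^1\setminus\{1\}$ and let the nodal fibre $X_0$ ($t=0$) be parametrized by $z\mapsto\big(x(z),y(z)\big)=\Big(\frac{4z}{(z-1)^2},\frac{4z(z+1)}{(z-1)^3}\Big)$, where $z=0$ and $z=\infty$ both map to the node. A combination $\sum_j r_j\{f_j,g_j\}$ of symbols in functions of $z$ defines the cycle $\sum_j r_j\,(z,f_j(z),g_j(z))$ of codimension $2$ in $\square^3$. Write $a$ and $c=-b$ also for the pullbacks of these functions along $z\mapsto(x(z),y(z))$. Then: 1. In $\mathbb Q\otimes\mathbb C(z)^\times\otimes\mathbb C(z)^\times$ the restriction of $\xi''$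 to $X_0$ equals $\big\{\tfrac{\mathbf i a^3}{8},\tfrac{\mathbf i c^3}{8}\big\}+3\big\{\tfrac ca,-\tfrac{4\mathbf i}{27}\big\}$ (the two differ by roots of unity only). The cycle $$\xi_0=\Big(z,\tfrac{\mathbf i a^3}{8},\tfrac{\mathbf i c^3}{8}\Big)+3\Big(z,\tfrac ca,-\tfrac{4\mathbf i}{27}\Big)$$ meets all faces of $\square^3$ properly, is in good position with respect to the real chains $T_1$, $T_1\cap T_2$, $T_1\cap T_2\cap T_3$, where $T_i=\{z_i\in[-\infty,0]\}$, and to their traces on the facets, and is closed in the cubical cycle complex. Hence it defines a class in $CH^2(\mathrm{Spec}\,\mathbb C,3)_{\mathbb Q}$, whose Abel–Jacobi invariant is represented by $$R=\frac1{2\pi\mathbf i}\int_{\xi_0}R_3,\qquad \int_{V}R_3=-2\pi\mathbf i\int_{V\cap T_1}\log z_2\,\mathrm{dlog}\,z_3+(2\pi\mathbf i)^2\sum_{V\cap T_1\cap T_2}\pm\log z_3\quad\text{for a curve }V\subset\square^3,$$ with principal logarithms, $T_i$ oriented from $-\infty$ to $0$, and the sign $\pm$ being the multiplicity of the point in the oriented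 intersection $V\cap T_1\cap T_2$. 2. $24\pi\log 2\le\operatorname{Im}R\le 60\pi\log 2$. 3. The class of $R$, i.e. $AJ(\xi_0)$, is nonzero in $H^1_{\mathcal D}(\mathrm{Spec}\,\mathbb C,\mathbb Q(2))=\mathbb C/(2\pi\mathbf i)^2\mathbb Q=\mathbb C/\mathbb Q\pi^2$. -/

import Mathlib

open scoped TensorProduct

noncomputable section

namespace NodalRegulator

/-! ### The cubical cycle complex of `Spec ℂ` and its homology

`□ = ℙ¹ ∖ {1}` is identified with `𝔸¹` through `u = z / (z - 1)`, so that `z = u / (u - 1)`; the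
facet `z = 0` becomes `u = 0` and the facet `z = ∞` becomes `u = 1`.  Thus `□ⁿ = 𝔸ⁿ`, and an
irreducible closed subvariety of `□ⁿ` is a prime ideal of `ℂ[u₁, …, uₙ]`. -/

/-- The coordinate ring of `□ⁿ`, with coordinates `uᵢ = zᵢ / (zᵢ - 1)`. -/
abbrev CubeRing (n : ℕ) : Type := MvPolynomial (Fin n) ℂ

/-- The value of `u` on the facet `z = 0` (`false`) and on the facet `z = ∞` (`true`). -/
def facetValue (e : Bool) : ℂ := if e then 1 else 0

/-- The ideal of the face of `□ⁿ` on which the coordinates in `I` are fixed to the values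
prescribed by `e`. -/
def faceIdeal {n : ℕ} (I : Finset (Fin n)) (e : Fin n → Bool) : Ideal (CubeRing n) :=
  Ideal.span ((fun i => MvPolynomial.X i - MvPolynomial.C (facetValue (e i))) '' (I : Set (Fin n)))

/-- `P` is an irreducible closed subvariety of codimension `p` of `□ⁿ` that meets every face
properly: every component of its intersection with a face `F` has codimension at least `p` in `F`,
that is codimension at least `p + codim F` in `□ⁿ`.  (The unit ideal has height `⊤`.) -/
def IsAdmissible {n : ℕ} (p : ℕ) (P : Ideal (CubeRing n)) : Prop :=
  P.IsPrime ∧ P.height = p ∧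
    ∀ (I : Finset (Fin n)) (e : Fin n → Bool), ((p + I.card : ℕ) : ℕ∞) ≤ (P ⊔ faceIdeal I e).height

/-- Rational combinations of ideals of `ℂ[u₁, …, uₙ]`; the algebraic cycles are those supported
on suitable prime ideals. -/
abbrev Chains (n : ℕ) : Type := Ideal (CubeRing n) →₀ ℚ

/-- The group `c^p(Spec ℂ, n) ⊗ ℚ` of admissible cycles of codimension `p` on `□ⁿ`. -/
def admissibleCycles (p n : ℕ) : Submodule ℚ (Chains n) :=
  Finsupp.supported ℚ ℚ {P | IsAdmissible p P}

/-- The length of the local ring at `Q` of the closed subscheme cut out by `J`. -/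
def multiplicity {n : ℕ} (J Q : Ideal (CubeRing n)) : ℕ :=
  open Classical in
  if _hQ : Q.IsPrime then
    (Module.length (Localization.AtPrime Q)
      (Localization.AtPrime Q ⧸ J.map (algebraMap (CubeRing n) (Localization.AtPrime Q)))).toNat
  else 0

/-- The cycle of the closed subscheme cut out by `J`: its irreducible components, each counted with
the length of the local ring at its generic point. -/
def schemeCycle {n : ℕ} (J : Ideal (CubeRing n)) : Chains n :=
  ∑ᶠ Q ∈ J.minimalPrimes, Finsupp.single Q (multiplicity J Q : ℚ)

/-- Restriction of functions from `□ⁿ⁺¹` to the facet `uᵢ = 0` or `uᵢ = 1`, identified with `□ⁿ`. -/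
def facetHom {n : ℕ} (i : Fin (n + 1)) (e : Bool) : CubeRing (n + 1) →ₐ[ℂ] CubeRing n :=
  MvPolynomial.aeval
    (i.insertNth (α := fun _ => CubeRing n) (MvPolynomial.C (facetValue e)) MvPolynomial.X)

/-- The intersection of a cycle with a facet. -/
def facetRestriction {n : ℕ} (i : Fin (n + 1)) (e : Bool) : Chains (n + 1) →ₗ[ℚ] Chains n :=
  Finsupp.linearCombination ℚ fun P => schemeCycle (P.map (facetHom i e))

/-- The cubical boundary `∂ = ∑ⱼ (-1)^(j-1) (∂ⱼ⁰ - ∂ⱼ^∞)`, with `j = i + 1`. -/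
def boundary (n : ℕ) : Chains (n + 1) →ₗ[ℚ] Chains n :=
  ∑ i : Fin (n + 1), (-1 : ℚ) ^ (i : ℕ) • (facetRestriction i false - facetRestriction i true)

/-- The degenerate cycles, spanned by the pullbacks along the coordinate projections. -/
def degenerateCycles (p : ℕ) : (n : ℕ) → Submodule ℚ (Chains n)
  | 0 => ⊥
  | n + 1 => Submodule.span ℚ
      {Z | ∃ (j : Fin (n + 1)) (Q : Ideal (CubeRing n)), IsAdmissible p Q ∧
        Z = Finsupp.single (Q.map (MvPolynomial.rename (R := ℂ) j.succAbove)) 1}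

/-- The admissible cycles whose boundary vanishes modulo degenerate cycles. -/
def closedCycles (p : ℕ) : (n : ℕ) → Submodule ℚ (Chains n)
  | 0 => admissibleCycles p 0
  | n + 1 => admissibleCycles p (n + 1) ⊓ (degenerateCycles p n).comap (boundary n)

/-- Boundaries of admissible cycles, together with the degenerate cycles. -/
def boundaryCycles (p n : ℕ) : Submodule ℚ (Chains n) :=
  (admissibleCycles p (n + 1)).map (boundary n) ⊔ degenerateCycles p n

/-- The higher Chow group `CH^p(Spec ℂ, n) ⊗ ℚ`. -/
abbrev HigherChow (p n : ℕ) : Type :=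
  closedCycles p n ⧸ (boundaryCycles p n).submoduleOf (closedCycles p n)

/-! ### The regulator of curves in `□³`

For a curve `V` in `□³` the current is
`∫_V R₃ = ∫_V log z₁ dlog z₂ ∧ dlog z₃ - 2πi ∫_{V ∩ T₁} log z₂ dlog z₃
  + (2πi)² ∑_{V ∩ T₁ ∩ T₂} ± log z₃`,
where `Tᵢ = {zᵢ ∈ [-∞, 0]} = {uᵢ ∈ [0, 1]}` is oriented from `zᵢ = -∞` to `zᵢ = 0` and `log` is the
principal branch.  The first term vanishes because `V` has complex dimension one. -/

/-- The interval `[-∞, 0]` in the coordinate `u`. -/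
def negAxis : Set ℂ := (fun s : ℝ => (s : ℂ)) '' Set.Icc 0 1

/-- The coordinate `z` as a function of `u`. -/
def zCoord (u : ℂ) : ℂ := u / (u - 1)

/-- The complex points of a closed subvariety of `□³`. -/
def points (P : Ideal (CubeRing 3)) : Set (Fin 3 → ℂ) := MvPolynomial.zeroLocus ℂ P

/-- The points of the curve lying above `u₁ = s`. -/
def fibre (P : Ideal (CubeRing 3)) (s : ℝ) : Set (Fin 3 → ℂ) :=
  {q | q ∈ points P ∧ q 0 = (s : ℂ)}

/-- The curve meets the real chains `T₁`, `T₁ ∩ T₂`, `T₁ ∩ T₂ ∩ T₃`, and their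
traces on the facets, properly: `V ∩ T₁` has real dimension at most one (equivalently the fibres of
`u₁` over `[0, 1]` are finite), `V ∩ T₁ ∩ T₂` is finite, and the other intersections are empty. -/
structure IsRealAdmissible (P : Ideal (CubeRing 3)) : Prop where
  dim_one : ∀ s ∈ Set.Icc (0 : ℝ) 1, (fibre P s).Finite
  dim_zero : {q | q ∈ points P ∧ q 0 ∈ negAxis ∧ q 1 ∈ negAxis}.Finite
  triple : ∀ q ∈ points P, ¬ (q 0 ∈ negAxis ∧ q 1 ∈ negAxis ∧ q 2 ∈ negAxis)
  facet_one : ∀ q ∈ points P, (q 0 = 0 ∨ q 0 = 1) → q 1 ∉ negAxis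
  facet_two : ∀ q ∈ points P, (q 1 = 0 ∨ q 1 = 1) → q 0 ∉ negAxis
  facet_three : ∀ q ∈ points P, (q 2 = 0 ∨ q 2 = 1) → q 0 ∉ negAxis

/-- `w` is the derivative `d/du₁` of the coordinates `(u₁, u₂, u₃)` along the curve at the
point `q`; it is unique at all points where `u₁` is a local parameter of the curve. -/
def IsTangent (P : Ideal (CubeRing 3)) (q w : Fin 3 → ℂ) : Prop :=
  w 0 = 1 ∧ ∀ F ∈ P, ∑ i, MvPolynomial.eval q (MvPolynomial.pderiv i F) * w i = 0

/-- The derivative `d/du₁` of the coordinates along the curve. -/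
def tangent (P : Ideal (CubeRing 3)) (q : Fin 3 → ℂ) : Fin 3 → ℂ :=
  Classical.epsilon (IsTangent P q)

/-- The coefficient of `du₁` in `log z₂ dlog z₃` along the curve; note that
`dlog z = - du / (u (u - 1))`. -/
def integrand (P : Ideal (CubeRing 3)) (q : Fin 3 → ℂ) : ℂ :=
  Complex.log (zCoord (q 1)) * (-(tangent P q 2) / (q 2 * (q 2 - 1)))

/-- `∫_{V ∩ T₁} log z₂ dlog z₃`: the sheets of `V` above `T₁` are summed, and `T₁` runs from
`z₁ = -∞` (`u₁ = 1`) to `z₁ = 0` (`u₁ = 0`). -/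
def lineIntegral (P : Ideal (CubeRing 3)) : ℂ :=
  ∫ s in (1 : ℝ)..0, ∑ᶠ q ∈ fibre P s, integrand P q

/-- The sum of `log z₂` over the points of `V` above `u₁ = s` at distance less than `ε` from `q`. -/
def localLog (P : Ideal (CubeRing 3)) (q : Fin 3 → ℂ) (ε s : ℝ) : ℂ :=
  ∑ᶠ q' ∈ fibre P s ∩ Metric.ball q ε, Complex.log (zCoord (q' 1))

/-- The jump of the principal branch of `log z₂` when the sheets of `V` above `T₁` pass through `q`
in the direction of `T₁` (decreasing `u₁`).  Since `d[log z₂] = dlog z₂ - 2πi δ_{T₂}`, it is `-2πi`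
times the multiplicity of `q` in `V ∩ T₁ ∩ T₂`. -/
def logJump (P : Ideal (CubeRing 3)) (q : Fin 3 → ℂ) : ℂ :=
  Filter.limUnder (nhdsWithin (0 : ℝ) (Set.Ioi 0)) fun ε : ℝ =>
    Filter.limUnder (nhdsWithin (0 : ℝ) (Set.Ioi 0)) fun δ : ℝ =>
      localLog P q ε ((q 0).re - δ) - localLog P q ε ((q 0).re + δ)

/-- The multiplicity (`±1` at a transversal point) of `q` in the zero-dimensional
chain `V ∩ T₁ ∩ T₂`. -/
def crossing (P : Ideal (CubeRing 3)) (q : Fin 3 → ℂ) : ℂ :=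
  -logJump P q / (2 * Real.pi * Complex.I)

/-- `∑_{V ∩ T₁ ∩ T₂} ± log z₃`. -/
def pointSum (P : Ideal (CubeRing 3)) : ℂ :=
  ∑ᶠ q ∈ {q | q ∈ points P ∧ q 0 ∈ negAxis ∧ q 1 ∈ negAxis},
    crossing P q * Complex.log (zCoord (q 2))

/-- `∫_V R₃` for an irreducible curve `V` in `□³`. -/
def currentR (P : Ideal (CubeRing 3)) : ℂ :=
  -(2 * Real.pi * Complex.I) * lineIntegral P + (2 * Real.pi * Complex.I) ^ 2 * pointSum P

/-- The regulator `(2πi)^(p - r) ∫_Z R_r` of cycles of codimension `p = 2` on `□ʳ`, `r = 3`. -/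
def regulator : Chains 3 →ₗ[ℚ] ℂ :=
  Finsupp.linearCombination ℚ fun P => (2 * Real.pi * Complex.I)⁻¹ * currentR P

/-- The closed cycles of codimension two on `□³` that are in good position with respect to the
real chains. -/
def realClosedCycles : Submodule ℚ (Chains 3) :=
  closedCycles 2 3 ⊓ Finsupp.supported ℚ ℚ {P | IsRealAdmissible P}

/-- The subgroup `ℚ(2) = (2πi)² ℚ` of `ℂ`. -/
def rationalTwist : Submodule ℚ ℂ := Submodule.span ℚ {(2 * Real.pi * Complex.I : ℂ) ^ 2}

/-- `H¹_𝒟(Spec ℂ, ℚ(2))`.  The Deligne complex of a point is concentrated in two degrees, where it is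
the inclusion `ℚ(2) → ℂ`. -/
abbrev DeligneH1 : Type := ℂ ⧸ rationalTwist

/-- The class in `CH²(Spec ℂ, 3) ⊗ ℚ` of a closed cycle in good position. -/
def chowClass : realClosedCycles →ₗ[ℚ] HigherChow 2 3 :=
  (Submodule.mkQ _).comp (Submodule.inclusion inf_le_left)

/-- The class of the regulator of a closed cycle in good position. -/
def regulatorClass : realClosedCycles →ₗ[ℚ] DeligneH1 :=
  rationalTwist.mkQ.comp (regulator.comp realClosedCycles.subtype)

/-- The graph of the Abel–Jacobi map `CH²(Spec ℂ, 3) ⊗ ℚ → H¹_𝒟(Spec ℂ, ℚ(2))`: it sends the class of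
a closed cycle in good position to the class of its regulator. -/
def abelJacobiGraph : Submodule ℚ (HigherChow 2 3 × DeligneH1) :=
  LinearMap.range (chowClass.prod regulatorClass)

/-! ### Symbols and graph cycles -/

/-- Rational combinations of symbols `{f, g}` of units of a ring, modulo bilinearity only.
(Rational Milnor `K₂` is the quotient of this by the Steinberg relations, so equality here is
stronger than equality in `K₂`.) -/
abbrev Symbols (R : Type) [CommRing R] : Type := ℚ ⊗[ℤ] (Additive Rˣ ⊗[ℤ] Additive Rˣ)

/-- The symbol `{f, g}`. -/
def symbol {R : Type} [CommRing R] (f g : Rˣ) : Symbols R :=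
  1 ⊗ₜ[ℤ] (Additive.ofMul f ⊗ₜ[ℤ] Additive.ofMul g)

/-- Functoriality of symbols. -/
def Symbols.map {R S : Type} [CommRing R] [CommRing S] (φ : R →+* S) : Symbols R →ₗ[ℤ] Symbols S :=
  let ψ : Additive Rˣ →ₗ[ℤ] Additive Sˣ :=
    (MonoidHom.toAdditive (Units.map (φ : R →* S))).toIntLinearMap
  TensorProduct.map LinearMap.id (TensorProduct.map ψ ψ)

/-- The function field `ℂ(z)` of `ℙ¹`. -/
abbrev FunField : Type := RatFunc ℂ

/-- The symbol represented by a formal combination of pairs `(f, g)`. -/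
def symbolSum (D : (FunFieldˣ × FunFieldˣ) →₀ ℚ) : Symbols FunField :=
  D.sum fun fg r => r • symbol fg.1 fg.2

/-- The function `u = h / (h - 1)` associated with `h`. -/
def uCoord (h : FunField) : FunField := h / (h - 1)

/-- The prime ideal of the curve in `□³` parametrized by `z ↦ (z, f(z), g(z))`. -/
def graphIdeal (f g : FunField) : Ideal (CubeRing 3) :=
  RingHom.ker (MvPolynomial.aeval (R := ℂ) ![uCoord RatFunc.X, uCoord f, uCoord g])

/-- The cycle `∑ r (z, f(z), g(z))` on `□³` of a formal combination of pairs `(f, g)`; a curve along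
which a coordinate is identically `1` lies outside `□³` and counts as zero. -/
def graphCycle : ((FunFieldˣ × FunFieldˣ) →₀ ℚ) →ₗ[ℚ] Chains 3 :=
  Finsupp.linearCombination ℚ fun fg =>
    open Classical in
    if fg.1 = 1 ∨ fg.2 = 1 then 0 else Finsupp.single (graphIdeal fg.1 fg.2) 1

/-! ### The elliptic surface, the class on it, and its restriction to the nodal fibre -/

/-- The coordinate ring `ℂ[x, y, t] / (y² - (x³ + x² + t))` of the (affine) elliptic surface. -/
abbrev SurfaceRing : Type :=
  MvPolynomial (Fin 3) ℂ ⧸ Ideal.span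
    {(MvPolynomial.X 1 ^ 2 -
      (MvPolynomial.X 0 ^ 3 + MvPolynomial.X 0 ^ 2 + MvPolynomial.X 2) : MvPolynomial (Fin 3) ℂ)}

/-- The coordinates `x, y, t` on the surface. -/
def coord (i : Fin 3) : SurfaceRing := Ideal.Quotient.mk _ (MvPolynomial.X i)

/-- Constants on the surface. -/
def const (c : ℂ) : SurfaceRing := algebraMap ℂ SurfaceRing c

/-- The function `iy + x + 2/3`. -/
def fnA : SurfaceRing := const Complex.I * coord 1 + coord 0 + const (2 / 3)

/-- The function `iy - x - 2/3`. -/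
def fnB : SurfaceRing := const Complex.I * coord 1 - coord 0 - const (2 / 3)

/-- The function `-t - 4/27`. -/
def fnD : SurfaceRing := -coord 2 - const (4 / 27)

/-- The coordinate ring of the open part of the surface on which the three functions are
invertible; it contains the node `x = y = t = 0`. -/
abbrev OpenRing : Type := Localization.Away (fnA * fnB * fnD)

theorem isUnit_prod : IsUnit (algebraMap SurfaceRing OpenRing (fnA * fnB * fnD)) :=
  IsLocalization.Away.algebraMap_isUnit _

theorem isUnit_fnA : IsUnit (algebraMap SurfaceRing OpenRing fnA) := by
  have h := isUnit_prod
  rw [map_mul, map_mul] at h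
  exact isUnit_of_mul_isUnit_left (isUnit_of_mul_isUnit_left h)

theorem isUnit_fnB : IsUnit (algebraMap SurfaceRing OpenRing fnB) := by
  have h := isUnit_prod
  rw [map_mul, map_mul] at h
  exact isUnit_of_mul_isUnit_right (isUnit_of_mul_isUnit_left h)

theorem isUnit_fnD : IsUnit (algebraMap SurfaceRing OpenRing fnD) := by
  have h := isUnit_prod
  rw [map_mul] at h
  exact isUnit_of_mul_isUnit_right h

/-- `iy + x + 2/3` as a unit. -/
def unitA : OpenRingˣ := isUnit_fnA.unit

/-- `iy - x - 2/3` as a unit. -/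
def unitB : OpenRingˣ := isUnit_fnB.unit

/-- `-t - 4/27` as a unit. -/
def unitD : OpenRingˣ := isUnit_fnD.unit

/-- A nonzero constant as a unit of a `ℂ`-algebra. -/
def unitConst (R : Type) [CommRing R] [Algebra ℂ R] (c : ℂ) (hc : c ≠ 0) : Rˣ :=
  Units.map (algebraMap ℂ R : ℂ →* R) (Units.mk0 c hc)

/-- The class
`ξ'' = {(iy + x + 2/3)³/8, (iy - x - 2/3)³/8} {(iy - x - 2/3)/(iy + x + 2/3), -t - 4/27}³`,
written additively. -/
def xiTwo : Symbols OpenRing :=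
  symbol (unitA ^ 3 / unitConst OpenRing 8 (by norm_num))
      (unitB ^ 3 / unitConst OpenRing 8 (by norm_num)) +
    (3 : ℚ) • symbol (unitB / unitA) unitD

/-- `x(z) = 4z / (z - 1)²`. -/
def xNodal : FunField := 4 * RatFunc.X / (RatFunc.X - 1) ^ 2

/-- `y(z) = 4z(z + 1) / (z - 1)³`. -/
def yNodal : FunField := 4 * RatFunc.X * (RatFunc.X + 1) / (RatFunc.X - 1) ^ 3

theorem X_sub_one_ne_zero : (RatFunc.X - 1 : FunField) ≠ 0 := by
  intro h
  have h1 : algebraMap (Polynomial ℂ) FunField (Polynomial.X - 1) = 0 := by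
    simpa using h
  have h2 := (map_eq_zero_iff _ (RatFunc.algebraMap_injective ℂ)).1 h1
  have h3 := congrArg (Polynomial.eval 0) h2
  simp at h3

theorem nodal_equation : yNodal ^ 2 - (xNodal ^ 3 + xNodal ^ 2 + 0) = 0 := by
  have h := X_sub_one_ne_zero
  unfold xNodal yNodal
  field_simp
  ring

/-- Restriction of functions to the nodal fibre `t = 0`, followed by the pullback along
`z ↦ (x(z), y(z))`. -/
def restrictSurface : SurfaceRing →ₐ[ℂ] FunField :=
  Ideal.Quotient.liftₐ _ (MvPolynomial.aeval ![xNodal, yNodal, 0]) (by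
    intro F hF
    have hle : Ideal.span
        {(MvPolynomial.X 1 ^ 2 -
          (MvPolynomial.X 0 ^ 3 + MvPolynomial.X 0 ^ 2 + MvPolynomial.X 2) :
            MvPolynomial (Fin 3) ℂ)} ≤
        RingHom.ker (MvPolynomial.aeval (R := ℂ) ![xNodal, yNodal, 0]) := by
      rw [Ideal.span_le, Set.singleton_subset_iff, SetLike.mem_coe, RingHom.mem_ker]
      simpa using nodal_equation
    exact hle hF)

theorem restrictSurface_coord (i : Fin 3) :
    restrictSurface (coord i) = ![xNodal, yNodal, 0] i := by
  change MvPolynomial.aeval ![xNodal, yNodal, 0] (MvPolynomial.X i : MvPolynomial (Fin 3) ℂ) = _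
  simp

theorem restrictSurface_const (c : ℂ) :
    restrictSurface (const c) = algebraMap ℂ FunField c := by
  simp [const]

theorem nodal_ne_zero (e : ℂ) :
    algebraMap ℂ FunField Complex.I * yNodal + algebraMap ℂ FunField e * (xNodal +
      algebraMap ℂ FunField (2 / 3)) = 0 → e = 0 := by
  intro h0
  have h := X_sub_one_ne_zero
  have key : algebraMap (Polynomial ℂ) FunField
      (Polynomial.C Complex.I * (4 * Polynomial.X * (Polynomial.X + 1)) +
        Polynomial.C e * (4 * Polynomial.X * (Polynomial.X - 1) +
          Polynomial.C (2 / 3) * (Polynomial.X - 1) ^ 3)) = 0 := by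
    have hC : ∀ c : ℂ, algebraMap (Polynomial ℂ) FunField (Polynomial.C c) =
        algebraMap ℂ FunField c := fun c => by
      rw [RatFunc.algebraMap_C, RatFunc.algebraMap_eq_C]
    have h1 := congrArg (fun w => w * (RatFunc.X - 1) ^ 3) h0
    simp only [xNodal, yNodal, zero_mul] at h1
    simp only [map_add, map_mul, map_sub, map_pow, hC, RatFunc.algebraMap_X, map_one]
    rw [← h1]
    have h4 : algebraMap (Polynomial ℂ) FunField 4 = 4 := map_ofNat _ 4
    rw [h4]
    field_simp
  have h2 := (map_eq_zero_iff _ (RatFunc.algebraMap_injective ℂ)).1 key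
  have h3 := congrArg (Polynomial.eval 0) h2
  simpa using h3

theorem isUnit_restrict : IsUnit ((restrictSurface : SurfaceRing →+* FunField)
    (fnA * fnB * fnD)) := by
  rw [isUnit_iff_ne_zero]
  have hA : restrictSurface fnA ≠ 0 := by
    intro h
    have := nodal_ne_zero 1 (by
      rw [← h]; simp [fnA, restrictSurface_coord, restrictSurface_const]; ring)
    exact one_ne_zero this
  have hB : restrictSurface fnB ≠ 0 := by
    intro h
    have := nodal_ne_zero (-1) (by
      rw [← h]; simp [fnB, restrictSurface_coord, restrictSurface_const]; ring)
    norm_num at this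
  have hD : restrictSurface fnD ≠ 0 := by
    have : restrictSurface fnD = algebraMap ℂ FunField (-(4 / 27)) := by
      rw [map_neg]
      simp only [fnD, map_sub, map_neg, restrictSurface_coord, restrictSurface_const]
      simp
    rw [this]
    exact (map_ne_zero _).2 (by norm_num)
  change restrictSurface (fnA * fnB * fnD) ≠ 0
  rw [map_mul, map_mul]
  exact mul_ne_zero (mul_ne_zero hA hB) hD

/-- The restriction of functions on the open part of the surface to the nodal fibre, pulled back to
its normalization `ℙ¹`. -/
def restrictNodal : OpenRing →+* FunField :=
  IsLocalization.Away.lift (fnA * fnB * fnD) isUnit_restrict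

/-- A representative of the restriction of `ξ''` to the nodal fibre: the formal combination
`(i a³/8, i c³/8) + 3 (c/a, -4i/27)` with `a = iy + x + 2/3` and `c = -(iy - x - 2/3)`
evaluated at `(x(z), y(z))`.  It differs from the literal restriction by roots of unity, which are
torsion, and is chosen such that the graph cycle is closed and in good position. -/
def nodalPairs : (FunFieldˣ × FunFieldˣ) →₀ ℚ :=
  let a : FunFieldˣ := Units.map (restrictNodal : OpenRing →* FunField) unitA
  let c : FunFieldˣ := -Units.map (restrictNodal : OpenRing →* FunField) unitB
  let k : FunFieldˣ := unitConst FunField (Complex.I / 8) (by simp)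
  Finsupp.single (k * a ^ 3, k * c ^ 3) 1 +
    Finsupp.single (c / a, unitConst FunField (-(4 * Complex.I) / 27) (by simp)) 3

/-- The cycle on `□³` representing the restriction of `ξ''` to the nodal fibre. -/
def nodalCycle : Chains 3 := graphCycle nodalPairs

end NodalRegulator

end

/-!
The nodal fibre is rational, and in the coordinate `u = z / (z - 1)` the functions `a` and `c = -b`
become cubic polynomials with `((a + c) / 2)³ = a c - 4/27`.  In this coordinate each of the two
curves of the cycle is `u₂ = q(u₁) / p(u₁)`, `u₃ = q'(u₁) / p'(u₁)` with coprime pairs of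
polynomials, and these two equations generate its prime ideal (`ker_aeval_eq_curveIdeal`).  Proper
intersection with the faces can then be read off from the points of the curve
(`isAdmissible_curveIdeal`), and a facet cuts the curve in a scheme `B(u₁) = 0`, `p(u₁) u₂ = q(u₁)`
whose cycle is given by the roots of `B` and their multiplicities (`schemeCycle_sectionIdeal`).  By
the relation between `a` and `c`, the function `i c³/8` has the value `k = -4i/27` at the zeros of
`a`, and so has `i a³/8` at the zeros of `c`.  The boundary of `(z, i a³/8, i c³/8)` is therefore
`-3` times that of `(z, c/a, k)`.  The contributions of `z = 0` and `z = ∞` cancel in each curve.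

For the regulator put `w = 2u - 1`.  For real `u` the values of `a` and `c` are complex conjugate,
`|a|² = (w² - 1/3)³ + 4/27` lies between `1/9` and `4/9` on `T₁`, and the argument of `a` increases
with `u`, by `2π` in total.  A continuous branch `H` of `log f`, with `f = i a³/8`, differs from the
principal branch by a step function which jumps where `f` crosses the negative axis.  With
`i c³/8 = -f̄` the line integral becomes the integral of `log f · dH̄`.  After partial integration
(`im_integral_log_mul_conj`) the jumps of the logarithm cancel the sum over `T₁ ∩ T₂`, and the
imaginary part of the regulator of the first curve is `-2 ∫ log |f| d(arg f)`
(`im_regulator_cubeCurve`).  Here `arg f` grows by `6π`, and `log |f|` lies between `-3 log 6` and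
`-3 log 3`.  The second curve contributes only through the two points where `c/a` is negative
(`im_regulator_quotientCurve`).  The sum of the contributions lies between `24π log 2` and
`60π log 2`.  It is not zero, while `ℚ(2)` is real, so the class is not zero.
-/

open scoped TensorProduct

noncomputable section

namespace NodalRegulator

/-! ### Curves in `□³` given by two equations -/

/-- The equation `p(uᵢ) uⱼ = q(uᵢ)`, which says that `uⱼ` is the rational function `q / p` of
`uᵢ`. -/
def linForm {n : ℕ} (i j : Fin n) (p q : Polynomial ℂ) : CubeRing n :=
  Polynomial.aeval (MvPolynomial.X i) p * MvPolynomial.X j - Polynomial.aeval (MvPolynomial.X i) q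

/-- The ideal of the curve `u₂ = q(u₁) / p(u₁)`, `u₃ = q'(u₁) / p'(u₁)` in `□³`, given by two
equations.  For coprime pairs the denominators are units modulo these equations. -/
def curveIdeal (p q p' q' : Polynomial ℂ) : Ideal (CubeRing 3) :=
  Ideal.span {linForm 0 1 p q, linForm 0 2 p' q'}

theorem algHom_linForm {n : ℕ} {A : Type*} [CommRing A] [Algebra ℂ A] (φ : CubeRing n →ₐ[ℂ] A)
    (i j : Fin n) (p q : Polynomial ℂ) :
    φ (linForm i j p q) = Polynomial.aeval (φ (MvPolynomial.X i)) p * φ (MvPolynomial.X j) -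
      Polynomial.aeval (φ (MvPolynomial.X i)) q := by
  simp [linForm, Polynomial.aeval_algHom_apply]

theorem eval_linForm {n : ℕ} (x : Fin n → ℂ) (i j : Fin n) (p q : Polynomial ℂ) :
    MvPolynomial.eval x (linForm i j p q) = p.eval (x i) * x j - q.eval (x i) := by
  have := algHom_linForm (MvPolynomial.aeval x) i j p q
  simpa [MvPolynomial.aeval_eq_eval, Polynomial.aeval_def] using this

theorem linForm_left_mem (p q p' q' : Polynomial ℂ) : linForm 0 1 p q ∈ curveIdeal p q p' q' :=
  Ideal.subset_span (by simp)

theorem linForm_right_mem (p q p' q' : Polynomial ℂ) : linForm 0 2 p' q' ∈ curveIdeal p q p' q' :=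
  Ideal.subset_span (by simp)

theorem mem_points_curveIdeal {p q p' q' : Polynomial ℂ} {x : Fin 3 → ℂ} :
    x ∈ points (curveIdeal p q p' q') ↔
      p.eval (x 0) * x 1 = q.eval (x 0) ∧ p'.eval (x 0) * x 2 = q'.eval (x 0) := by
  rw [points, curveIdeal, MvPolynomial.zeroLocus_span]
  simp [eval_linForm, sub_eq_zero, MvPolynomial.aeval_eq_eval]

theorem eval_ne_zero_of_coprime {p q : Polynomial ℂ} (h : IsCoprime p q) {s t : ℂ}
    (he : p.eval s * t = q.eval s) : p.eval s ≠ 0 := by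
  obtain ⟨α, β, hαβ⟩ := h
  intro h0
  have := congrArg (Polynomial.eval s) hαβ
  simp [← he, h0] at this

/-- The denominator is a unit wherever the equation `p(x) y = q(x)` of a coprime pair holds. -/
theorem isUnit_aeval_of_coprime {A : Type*} [CommRing A] [Algebra ℂ A] {p q : Polynomial ℂ}
    (h : IsCoprime p q) {x y : A} (he : Polynomial.aeval x p * y = Polynomial.aeval x q) :
    IsUnit (Polynomial.aeval x p) := by
  obtain ⟨α, β, hαβ⟩ := h
  have := congrArg (Polynomial.aeval x) hαβ
  simp only [map_add, map_mul, map_one] at this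
  refine IsUnit.of_mul_eq_one (Polynomial.aeval x α + Polynomial.aeval x β * y) ?_
  rw [← this, ← he]; ring

/-- The two equations generate the ideal of the curve parametrized by a transcendental element. -/
theorem ker_aeval_eq_curveIdeal {K : Type*} [Field K] [Algebra ℂ K] {u : K}
    (hu : Transcendental ℂ u) {p q p' q' : Polynomial ℂ} (hp : p ≠ 0) (hp' : p' ≠ 0)
    (h : IsCoprime p q) (h' : IsCoprime p' q') :
    RingHom.ker (MvPolynomial.aeval (R := ℂ)
      ![u, Polynomial.aeval u q / Polynomial.aeval u p,
        Polynomial.aeval u q' / Polynomial.aeval u p']) = curveIdeal p q p' q' := by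
  have hz : ∀ r : Polynomial ℂ, Polynomial.aeval u r = 0 → r = 0 := fun r hr =>
    (transcendental_iff.1 hu) r hr
  have hpu : Polynomial.aeval u p ≠ 0 := fun h0 => hp (hz p h0)
  have hpu' : Polynomial.aeval u p' ≠ 0 := fun h0 => hp' (hz p' h0)
  set φ : CubeRing 3 →ₐ[ℂ] K := MvPolynomial.aeval (R := ℂ)
      ![u, Polynomial.aeval u q / Polynomial.aeval u p,
        Polynomial.aeval u q' / Polynomial.aeval u p'] with hφ
  have hle : curveIdeal p q p' q' ≤ RingHom.ker φ := by
    rw [curveIdeal, Ideal.span_le]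
    rintro F (rfl | rfl)
    · rw [SetLike.mem_coe, RingHom.mem_ker, algHom_linForm]
      simp [hφ]; field_simp; simp
    · rw [SetLike.mem_coe, RingHom.mem_ker, algHom_linForm]
      simp [hφ]; field_simp; simp
  refine le_antisymm (fun F hF => ?_) hle
  set I := curveIdeal p q p' q'
  set π : CubeRing 3 →ₐ[ℂ] (CubeRing 3 ⧸ I) := Ideal.Quotient.mkₐ ℂ I with hπ
  have e1 : Polynomial.aeval (π (MvPolynomial.X 0)) p * π (MvPolynomial.X 1) =
      Polynomial.aeval (π (MvPolynomial.X 0)) q := by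
    rw [← sub_eq_zero, ← algHom_linForm]
    exact Ideal.Quotient.eq_zero_iff_mem.2 (linForm_left_mem p q p' q')
  have e2 : Polynomial.aeval (π (MvPolynomial.X 0)) p' * π (MvPolynomial.X 2) =
      Polynomial.aeval (π (MvPolynomial.X 0)) q' := by
    rw [← sub_eq_zero, ← algHom_linForm]
    exact Ideal.Quotient.eq_zero_iff_mem.2 (linForm_right_mem p q p' q')
  -- Modulo the equations every function is a quotient of two polynomials in `u₁`.
  have key : ∀ G : CubeRing 3, ∃ d r : Polynomial ℂ,
      IsUnit (Polynomial.aeval (π (MvPolynomial.X 0)) d) ∧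
      Polynomial.aeval (π (MvPolynomial.X 0)) d * π G =
        Polynomial.aeval (π (MvPolynomial.X 0)) r := by
    intro G
    induction G using MvPolynomial.induction_on with
    | C a =>
      refine ⟨1, Polynomial.C a, by simp, ?_⟩
      rw [map_one, one_mul, Polynomial.aeval_C]
      exact π.commutes a
    | add G₁ G₂ h₁ h₂ =>
      obtain ⟨d₁, r₁, u₁, h₁⟩ := h₁
      obtain ⟨d₂, r₂, u₂, h₂⟩ := h₂
      refine ⟨d₁ * d₂, r₁ * d₂ + r₂ * d₁, by rw [map_mul]; exact u₁.mul u₂, ?_⟩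
      simp only [map_mul, map_add, ← h₁, ← h₂]; ring
    | mul_X G i hG =>
      obtain ⟨d, r, hd, hG⟩ := hG
      fin_cases i
      · refine ⟨d, r * Polynomial.X, hd, ?_⟩
        simp only [map_mul, ← hG, Polynomial.aeval_X]
        simp only [Fin.zero_eta]; ring
      · refine ⟨d * p, r * q, by rw [map_mul]; exact hd.mul (isUnit_aeval_of_coprime h e1), ?_⟩
        simp only [map_mul, ← hG, ← e1]
        simp only [Fin.mk_one]; ring
      · refine ⟨d * p', r * q', by rw [map_mul]; exact hd.mul (isUnit_aeval_of_coprime h' e2), ?_⟩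
        simp only [map_mul, ← hG, ← e2]
        simp only [Fin.reduceFinMk]; ring
  obtain ⟨d, r, hd, hr⟩ := key F
  have hmem : Polynomial.aeval (MvPolynomial.X 0 : CubeRing 3) d * F -
      Polynomial.aeval (MvPolynomial.X 0 : CubeRing 3) r ∈ I := by
    rw [← Ideal.Quotient.eq_zero_iff_mem]
    change π _ = 0
    rw [map_sub, map_mul, ← Polynomial.aeval_algHom_apply, ← Polynomial.aeval_algHom_apply, hr,
      sub_self]
  have h0 := hle hmem
  rw [RingHom.mem_ker, map_sub, map_mul, RingHom.mem_ker.1 hF, mul_zero, zero_sub, neg_eq_zero,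
    ← Polynomial.aeval_algHom_apply] at h0
  have hr0 : r = 0 := hz r (by simpa [hφ] using h0)
  rw [hr0, map_zero] at hr
  exact Ideal.Quotient.eq_zero_iff_mem.1 ((hd.mul_right_eq_zero).1 hr)

theorem transcendental_X : Transcendental ℂ (RatFunc.X : RatFunc ℂ) := by
  rw [transcendental_iff]
  intro r hr
  have : algebraMap (Polynomial ℂ) (RatFunc ℂ) r = 0 := by
    rw [← hr, ← RatFunc.algebraMap_X, Polynomial.aeval_algebraMap_apply]
    simp
  exact (map_eq_zero_iff _ (RatFunc.algebraMap_injective ℂ)).1 this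

theorem curveIdeal_isPrime {p q p' q' : Polynomial ℂ} (hp : p ≠ 0) (hp' : p' ≠ 0)
    (h : IsCoprime p q) (h' : IsCoprime p' q') : (curveIdeal p q p' q').IsPrime := by
  rw [← ker_aeval_eq_curveIdeal transcendental_X hp hp' h h']
  exact RingHom.ker_isPrime _

theorem curveIdeal_height {p q p' q' : Polynomial ℂ} (hp : p ≠ 0) (hp' : p' ≠ 0)
    (h : IsCoprime p q) (h' : IsCoprime p' q') : (curveIdeal p q p' q').height = 2 := by
  have hP := curveIdeal_isPrime hp hp' h h'
  apply le_antisymm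
  · have h2 := Ideal.height_le_card_of_mem_minimalPrimes_span (p := curveIdeal p q p' q')
      (s := {linForm 0 1 p q, linForm 0 2 p' q'}) (Set.toFinite _) (by
        change curveIdeal p q p' q' ∈ (curveIdeal p q p' q').minimalPrimes
        rw [Ideal.minimalPrimes_eq_subsingleton_self]; rfl)
    have h3 : ({linForm 0 1 p q, linForm 0 2 p' q'} : Set (CubeRing 3)).ncard ≤ 2 :=
      (Set.ncard_insert_le _ _).trans (by simp)
    exact h2.trans (by exact_mod_cast h3)
  · -- Forgetting the equation of `u₃` gives an intermediate prime.
    let K := RatFunc ℂ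
    let u : K := RatFunc.X
    have hz : ∀ r : Polynomial ℂ, Polynomial.aeval u r = 0 → r = 0 := fun r hr =>
      (transcendental_iff.1 transcendental_X) r hr
    have hpu : Polynomial.aeval u p ≠ 0 := fun h0 => hp (hz p h0)
    have hpu' : Polynomial.aeval u p' ≠ 0 := fun h0 => hp' (hz p' h0)
    let φ : CubeRing 3 →ₐ[ℂ] Polynomial K := MvPolynomial.aeval (R := ℂ)
      ![Polynomial.C u, Polynomial.C (Polynomial.aeval u q / Polynomial.aeval u p), Polynomial.X]
    let ev : Polynomial K →ₐ[ℂ] K := (Polynomial.aeval (R := K)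
      (Polynomial.aeval u q' / Polynomial.aeval u p')).restrictScalars ℂ
    have hC : ∀ r : Polynomial ℂ, Polynomial.aeval (Polynomial.C u : Polynomial K) r =
        Polynomial.C (Polynomial.aeval u r) := fun r =>
      Polynomial.aeval_algHom_apply (IsScalarTower.toAlgHom ℂ K (Polynomial K)) u r
    have hcomp : ev.comp φ = MvPolynomial.aeval (R := ℂ)
      ![u, Polynomial.aeval u q / Polynomial.aeval u p,
        Polynomial.aeval u q' / Polynomial.aeval u p'] := by
      ext i
      fin_cases i <;> simp [φ, ev]
    have hle : RingHom.ker φ ≤ curveIdeal p q p' q' := by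
      rw [← ker_aeval_eq_curveIdeal transcendental_X hp hp' h h']
      intro F hF
      rw [RingHom.mem_ker] at hF ⊢
      rw [show MvPolynomial.aeval (R := ℂ) ![RatFunc.X, _, _] = ev.comp φ from hcomp.symm]
      simp [hF]
    have hlt : RingHom.ker φ < curveIdeal p q p' q' := by
      refine lt_of_le_of_ne hle fun heq => ?_
      have h1 := linForm_right_mem p q p' q'
      rw [← heq, RingHom.mem_ker, algHom_linForm] at h1
      have h2 := congrArg (fun F => Polynomial.coeff F 1) h1
      simp [φ, hC, hpu', Polynomial.coeff_C] at h2
    have hbot : ⊥ < RingHom.ker φ := by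
      refine bot_lt_iff_ne_bot.2 fun hb => ?_
      have h1 : linForm 0 1 p q ∈ RingHom.ker φ := by
        rw [RingHom.mem_ker, algHom_linForm]
        simp only [φ, MvPolynomial.aeval_X, Matrix.cons_val_zero, Matrix.cons_val_one, hC,
          ← map_mul, mul_div_cancel₀ _ hpu, sub_self]
      rw [hb, Ideal.mem_bot] at h1
      obtain ⟨s, hs⟩ : ∃ s, p.eval s ≠ 0 := by
        by_contra! hcon
        exact hp (Polynomial.funext fun s => by simpa using hcon s)
      have h2 := eval_linForm ![s, (q.eval s + 1) / p.eval s, 0] 0 1 p q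
      simp [h1, mul_div_cancel₀ _ hs] at h2
    have hprime : (RingHom.ker φ).IsPrime := RingHom.ker_isPrime _
    have l1 := Ideal.height_add_one_le_of_lt_of_isPrime hlt
    have l2 := Ideal.height_add_one_le_of_lt_of_isPrime hbot
    rw [Ideal.height_bot, zero_add] at l2
    calc (2 : ℕ∞) = 1 + 1 := by norm_num
      _ ≤ _ := (add_le_add_left l2 1).trans l1

/-- A curve that lies in no facet and has no point on two facets of different directions meets all
faces properly: facets cut it in an ideal of larger height, and faces of codimension two or three
do not meet it, by the Nullstellensatz. -/
theorem isAdmissible_curveIdeal {p q p' q' : Polynomial ℂ} (hp : p ≠ 0) (hp' : p' ≠ 0)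
    (h : IsCoprime p q) (h' : IsCoprime p' q')
    (hface : ∀ x ∈ points (curveIdeal p q p' q'), ∀ i j, i < j →
      (x i = 0 ∨ x i = 1) → ¬ (x j = 0 ∨ x j = 1))
    (hgen : ∃ x ∈ points (curveIdeal p q p' q'), ∀ i, ¬ (x i = 0 ∨ x i = 1)) :
    IsAdmissible 2 (curveIdeal p q p' q') := by
  have hP := curveIdeal_isPrime hp hp' h h'
  have hht := curveIdeal_height hp hp' h h'
  refine ⟨hP, hht, fun I e => ?_⟩
  have hval : ∀ b, facetValue b = 0 ∨ facetValue b = 1 := by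
    intro b; cases b <;> simp [facetValue]
  rcases lt_trichotomy I.card 1 with hI | hI | hI
  · have : I = ∅ := by simpa using hI
    subst this
    simp [faceIdeal, hht]
  · obtain ⟨i, rfl⟩ := Finset.card_eq_one.1 hI
    have hlt : curveIdeal p q p' q' < curveIdeal p q p' q' ⊔ faceIdeal {i} e := by
      refine lt_of_le_of_ne le_sup_left fun heq => ?_
      have h1 : MvPolynomial.X i - MvPolynomial.C (facetValue (e i)) ∈ curveIdeal p q p' q' := by
        rw [heq]
        exact Ideal.mem_sup_right (Ideal.subset_span (by simp))
      obtain ⟨x, hx, hx'⟩ := hgen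
      have h2 := (MvPolynomial.mem_zeroLocus_iff.1 hx) _ h1
      simp only [map_sub, MvPolynomial.aeval_X, MvPolynomial.aeval_C, Algebra.algebraMap_self,
        RingHom.id_apply, sub_eq_zero] at h2
      exact hx' i (h2 ▸ hval (e i))
    have := Ideal.height_strict_mono_of_isPrime hlt
    rw [hht] at this
    have h3 := Order.add_one_le_of_lt this
    simpa [show (2 : ℕ∞) + 1 = 3 by norm_num] using h3
  · have htop : curveIdeal p q p' q' ⊔ faceIdeal I e = ⊤ := by
      by_contra hne
      obtain ⟨M, hM, hle⟩ := Ideal.exists_le_maximal _ hne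
      obtain ⟨x, rfl⟩ := MvPolynomial.isMaximal_iff_eq_vanishingIdeal_singleton.1 hM
      have hx : x ∈ points (curveIdeal p q p' q') := by
        rw [points, MvPolynomial.mem_zeroLocus_iff]
        intro F hF
        exact (MvPolynomial.mem_vanishingIdeal_singleton_iff _ _).1 (hle (Ideal.mem_sup_left hF))
      have hxe : ∀ i ∈ I, x i = 0 ∨ x i = 1 := by
        intro i hi
        have h1 := (MvPolynomial.mem_vanishingIdeal_singleton_iff _ _).1
          (hle (Ideal.mem_sup_right (Ideal.subset_span ⟨i, hi, rfl⟩)))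
        simp only [map_sub, MvPolynomial.aeval_X, MvPolynomial.aeval_C, Algebra.algebraMap_self,
          RingHom.id_apply, sub_eq_zero] at h1
        exact h1 ▸ hval (e i)
      obtain ⟨i, hi, j, hj, hij⟩ := Finset.one_lt_card.1 hI
      rcases lt_or_gt_of_ne hij with hlt | hlt
      · exact hface x hx i j hlt (hxe i hi) (hxe j hj)
      · exact hface x hx j i hlt (hxe j hj) (hxe i hi)
    rw [htop, Ideal.height_top]
    exact le_top

/-! ### Multiplicities and cycles of facet sections -/

/-- In a local ring whose maximal ideal is generated by `x` modulo `J`, the length of the quotient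
by `J` is the order of nilpotency of `x`. -/
theorem length_quotient_eq_of_maximalIdeal {A : Type*} [CommRing A] [IsLocalRing A] (J : Ideal A)
    (x : A) (m : ℕ) (hmax : J ⊔ Ideal.span {x} = IsLocalRing.maximalIdeal A)
    (h1 : x ^ (m + 1) ∈ J) (h2 : x ^ m ∉ J) : Module.length A (A ⧸ J) = (m + 1 : ℕ) := by
  have hx : x ∈ IsLocalRing.maximalIdeal A :=
    hmax ▸ Ideal.mem_sup_right (Ideal.mem_span_singleton_self x)
  have key : ∀ k : ℕ, k ≤ m + 1 → Module.length A (A ⧸ (J ⊔ Ideal.span {x ^ k})) = k := by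
    intro k
    induction k with
    | zero =>
      intro _
      have : Subsingleton (A ⧸ (J ⊔ Ideal.span {x ^ 0})) := by
        rw [Ideal.Quotient.subsingleton_iff]; simp
      simp [Module.length_eq_zero]
    | succ k ih =>
      intro hk
      have hle : J ⊔ Ideal.span {x ^ (k + 1)} ≤ J ⊔ Ideal.span {x ^ k} :=
        sup_le_sup_left (Ideal.span_singleton_le_span_singleton.2 (pow_dvd_pow x (Nat.le_succ k))) J
      have hmul : IsLocalRing.maximalIdeal A ≤
          Submodule.comap (LinearMap.mulRight A (x ^ k)) (J ⊔ Ideal.span {x ^ (k + 1)}) := by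
        rw [← hmax]
        refine sup_le (fun j hj => ?_) ?_
        · exact Ideal.mem_sup_left (J.mul_mem_right _ hj)
        · rw [Ideal.span_le, Set.singleton_subset_iff]
          refine Ideal.mem_sup_right ?_
          rw [LinearMap.mulRight_apply, ← pow_succ']
          exact Ideal.mem_span_singleton_self _
      let f : (A ⧸ IsLocalRing.maximalIdeal A) →ₗ[A] (A ⧸ (J ⊔ Ideal.span {x ^ (k + 1)})) :=
        Submodule.mapQ _ _ (LinearMap.mulRight A (x ^ k)) hmul
      let g : (A ⧸ (J ⊔ Ideal.span {x ^ (k + 1)})) →ₗ[A] (A ⧸ (J ⊔ Ideal.span {x ^ k})) :=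
        Submodule.factor hle
      have hf : Function.Injective f := by
        rw [← LinearMap.ker_eq_bot, LinearMap.ker_eq_bot']
        intro a
        obtain ⟨a, rfl⟩ := Submodule.mkQ_surjective _ a
        intro ha
        have ha' : a * x ^ k ∈ J ⊔ Ideal.span {x ^ (k + 1)} :=
          (Submodule.Quotient.mk_eq_zero _).1 ha
        refine (Submodule.Quotient.mk_eq_zero _).2 ?_
        by_contra hu
        have hu' : IsUnit a := by simpa using hu
        obtain ⟨b, hb⟩ := hu'.exists_left_inv
        have hxk := (J ⊔ Ideal.span {x ^ (k + 1)}).mul_mem_left b ha'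
        rw [← mul_assoc, hb, one_mul] at hxk
        obtain ⟨j, hj, c, hc, hjc⟩ := Submodule.mem_sup.1 hxk
        obtain ⟨d, rfl⟩ := Ideal.mem_span_singleton'.1 hc
        have hunit : IsUnit (1 - d * x) :=
          IsLocalRing.isUnit_one_sub_self_of_mem_nonunits _
            ((IsLocalRing.maximalIdeal A).mul_mem_left d hx)
        have : x ^ k * (1 - d * x) ∈ J := by
          have : x ^ k * (1 - d * x) = j := by
            rw [mul_sub, mul_one]
            nth_rewrite 1 [← hjc]
            ring
          rwa [this]
        have hk' : x ^ k ∈ J := (Ideal.mul_unit_mem_iff_mem J hunit).1 this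
        refine h2 ?_
        rw [← Nat.sub_add_cancel (show k ≤ m by omega), pow_add]
        exact J.mul_mem_left _ hk'
      have hg : Function.Surjective g := Submodule.factor_surjective hle
      have hfg : Function.Exact f g := by
        intro y
        obtain ⟨y, rfl⟩ := Submodule.mkQ_surjective _ y
        constructor
        · intro hy
          have hy' : y ∈ J ⊔ Ideal.span {x ^ k} := (Submodule.Quotient.mk_eq_zero _).1 hy
          obtain ⟨j, hj, c, hc, rfl⟩ := Submodule.mem_sup.1 hy'
          obtain ⟨d, rfl⟩ := Ideal.mem_span_singleton'.1 hc
          refine ⟨Submodule.Quotient.mk d, ?_⟩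
          refine (Submodule.Quotient.eq _).2 ?_
          rw [LinearMap.mulRight_apply]
          have : d * x ^ k - (j + d * x ^ k) = -j := by ring
          rw [this]
          exact neg_mem (Ideal.mem_sup_left hj)
        · rintro ⟨a, ha⟩
          obtain ⟨a, rfl⟩ := Submodule.mkQ_surjective _ a
          rw [← ha]
          refine (Submodule.Quotient.mk_eq_zero _).2 ?_
          exact Ideal.mem_sup_right (Ideal.mul_mem_left _ _ (Ideal.mem_span_singleton_self _))
      have : IsSimpleModule A (A ⧸ IsLocalRing.maximalIdeal A) := by
        rw [isSimpleModule_iff_isCoatom]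
        exact (IsLocalRing.maximalIdeal.isMaximal A).out
      rw [Module.length_eq_add_of_exact f g hf hg hfg, ih (by omega), Module.length_eq_one]
      push_cast
      ring
  have hJ : J ⊔ Ideal.span {x ^ (m + 1)} = J := by
    rw [sup_eq_left, Ideal.span_le, Set.singleton_subset_iff]; exact h1
  have := key (m + 1) le_rfl
  rwa [hJ] at this

/-- The maximal ideal of a point of `□ⁿ`. -/
def pointIdeal {n : ℕ} (x : Fin n → ℂ) : Ideal (CubeRing n) := RingHom.ker (MvPolynomial.eval x)

instance pointIdeal_isMaximal {n : ℕ} (x : Fin n → ℂ) : (pointIdeal x).IsMaximal :=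
  RingHom.ker_isMaximal_of_surjective _ fun c => ⟨MvPolynomial.C c, by simp⟩

theorem mem_pointIdeal {n : ℕ} {x : Fin n → ℂ} {F : CubeRing n} :
    F ∈ pointIdeal x ↔ MvPolynomial.eval x F = 0 := RingHom.mem_ker

/-- The ideal of `□²` cut out by `B(u₁) = 0` and `p(u₁) u₂ = q(u₁)`. -/
def sectionIdeal (B p q : Polynomial ℂ) : Ideal (CubeRing 2) :=
  Ideal.span {Polynomial.aeval (MvPolynomial.X 0) B, linForm 0 1 p q}

theorem sub_C_dvd_aeval_sub {n : ℕ} (i : Fin n) (r : ℂ) (p : Polynomial ℂ) :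
    (MvPolynomial.X i - MvPolynomial.C r : CubeRing n) ∣
      Polynomial.aeval (MvPolynomial.X i) p - MvPolynomial.C (p.eval r) := by
  obtain ⟨g, hg⟩ := Polynomial.X_sub_C_dvd_sub_C_eval (a := r) (p := p)
  refine ⟨Polynomial.aeval (MvPolynomial.X i) g, ?_⟩
  have := congrArg (Polynomial.aeval (MvPolynomial.X i : CubeRing n)) hg
  simpa [MvPolynomial.algebraMap_eq] using this

/-- An ideal containing `u₁ - r` and `p(u₁) u₂ - q(u₁)`, where `p(r) ≠ 0`, contains the ideal of
the point `(r, q(r) / p(r))`. -/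
theorem pointIdeal_le {I : Ideal (CubeRing 2)} {p q : Polynomial ℂ} {r : ℂ} (hp : p.eval r ≠ 0)
    (h1 : MvPolynomial.X 0 - MvPolynomial.C r ∈ I) (h2 : linForm 0 1 p q ∈ I) :
    pointIdeal ![r, q.eval r / p.eval r] ≤ I := by
  set s := q.eval r / p.eval r with hs
  have h3 : (MvPolynomial.X 1 - MvPolynomial.C s : CubeRing 2) ∈ I := by
    have hd : ∀ p : Polynomial ℂ,
        Polynomial.aeval (MvPolynomial.X 0) p - MvPolynomial.C (p.eval r) ∈ I :=
      fun p => I.mem_of_dvd (sub_C_dvd_aeval_sub 0 r p) h1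
    have h4 :
        (MvPolynomial.C (p.eval r) * (MvPolynomial.X 1 - MvPolynomial.C s) : CubeRing 2) ∈ I := by
      have : (MvPolynomial.C (p.eval r) * (MvPolynomial.X 1 - MvPolynomial.C s) : CubeRing 2) =
          linForm 0 1 p q - (Polynomial.aeval (MvPolynomial.X 0) p -
            MvPolynomial.C (p.eval r)) * MvPolynomial.X 1 +
          (Polynomial.aeval (MvPolynomial.X 0) q - MvPolynomial.C (q.eval r)) := by
        rw [show q.eval r = p.eval r * s by rw [hs]; field_simp, map_mul, linForm]; ring
      rw [this]
      exact add_mem (sub_mem h2 (I.mul_mem_right _ (hd p))) (hd q)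
    have h5 := I.mul_mem_left (MvPolynomial.C (p.eval r)⁻¹) h4
    rwa [← mul_assoc, ← map_mul, inv_mul_cancel₀ hp, map_one, one_mul] at h5
  have key : ∀ F : CubeRing 2, F - MvPolynomial.C (MvPolynomial.eval ![r, s] F) ∈ I := by
    intro F
    induction F using MvPolynomial.induction_on with
    | C a => simp
    | add F G hF hG =>
      have := add_mem hF hG
      rw [map_add, map_add]
      convert this using 1; ring
    | mul_X F i hF =>
      have hi : MvPolynomial.X i - MvPolynomial.C (![r, s] i) ∈ I := by
        fin_cases i
        · exact h1
        · exact h3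
      have := add_mem (I.mul_mem_right (MvPolynomial.X i) hF)
        (I.mul_mem_left (MvPolynomial.C (MvPolynomial.eval ![r, s] F)) hi)
      rw [map_mul, map_mul, MvPolynomial.eval_X]
      convert this using 1; ring
  intro F hF
  have := key F
  rwa [mem_pointIdeal.1 hF, map_zero, sub_zero] at this

/-- The cycle of `B(u₁) = 0`, `p(u₁) u₂ = q(u₁)` when all roots of `B` have the same multiplicity:
the roots of `B` are counted with this multiplicity. -/
theorem schemeCycle_sectionIdeal (T : Finset ℂ) (m : ℕ) {k : ℂ} (hk : k ≠ 0) {B p q : Polynomial ℂ}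
    (hB : B = Polynomial.C k * ∏ r ∈ T, (Polynomial.X - Polynomial.C r) ^ (m + 1))
    (hp : ∀ r ∈ T, p.eval r ≠ 0) :
    schemeCycle (sectionIdeal B p q) =
      ∑ r ∈ T, Finsupp.single (pointIdeal ![r, q.eval r / p.eval r]) ((m + 1 : ℕ) : ℚ) := by
  classical
  set pt : ℂ → Ideal (CubeRing 2) := fun r => pointIdeal ![r, q.eval r / p.eval r] with hpt
  have hBX : Polynomial.aeval (MvPolynomial.X 0 : CubeRing 2) B = MvPolynomial.C k *
      ∏ r ∈ T, (MvPolynomial.X 0 - MvPolynomial.C r) ^ (m + 1) := by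
    rw [hB]; simp [map_prod, MvPolynomial.algebraMap_eq]
  have hBmem : Polynomial.aeval (MvPolynomial.X 0) B ∈ sectionIdeal B p q :=
    Ideal.subset_span (by simp)
  have hlmem : linForm 0 1 p q ∈ sectionIdeal B p q := Ideal.subset_span (by simp)
  have hX : ∀ r, MvPolynomial.X 0 - MvPolynomial.C r ∈ pt r := fun r => by
    simp [hpt, mem_pointIdeal]
  have hle : ∀ r ∈ T, sectionIdeal B p q ≤ pt r := by
    intro r hr
    rw [sectionIdeal, Ideal.span_le]
    rintro F (rfl | rfl)
    · rw [hBX]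
      exact (pt r).mul_mem_left _ ((pt r).mem_of_dvd (Finset.dvd_prod_of_mem _ hr)
        ((pt r).pow_mem_of_mem (hX r) _ (Nat.succ_pos m)))
    · rw [SetLike.mem_coe, mem_pointIdeal, eval_linForm]
      simp [mul_div_cancel₀ _ (hp r hr)]
  have hinj : ∀ r r', pt r ≤ pt r' → r = r' := by
    intro r r' h
    have h1 := mem_pointIdeal.1 (h (hX r))
    simpa [sub_eq_zero, eq_comm] using h1
  have habove : ∀ P : Ideal (CubeRing 2), P.IsPrime → sectionIdeal B p q ≤ P →
      ∃ r ∈ T, pt r ≤ P := by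
    intro P hP hJP
    have h1 := hJP hBmem
    rw [hBX] at h1
    rcases hP.mem_or_mem h1 with h2 | h2
    · exact absurd (P.eq_top_of_isUnit_mem h2 ((isUnit_iff_ne_zero.2 hk).map MvPolynomial.C))
        hP.ne_top
    · obtain ⟨r, hr, h3⟩ := (hP.prod_mem_iff).1 h2
      exact ⟨r, hr, pointIdeal_le (hp r hr) (hP.mem_of_pow_mem _ h3) (hJP hlmem)⟩
  have hmin : (sectionIdeal B p q).minimalPrimes = ((T.image pt : Finset _) : Set _) := by
    ext P
    simp only [Finset.coe_image, Set.mem_image, SetLike.mem_coe]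
    constructor
    · rintro ⟨⟨hP, hJP⟩, hPmin⟩
      obtain ⟨r, hr, hrP⟩ := habove P hP hJP
      exact ⟨r, hr, le_antisymm hrP
        (hPmin ⟨(pointIdeal_isMaximal _).isPrime, hle r hr⟩ hrP)⟩
    · rintro ⟨r, hr, rfl⟩
      refine ⟨⟨(pointIdeal_isMaximal _).isPrime, hle r hr⟩, fun P hP hPr => ?_⟩
      obtain ⟨r', hr', hrP⟩ := habove P hP.1 hP.2
      rw [hinj r' r (hrP.trans hPr)] at hrP
      exact hrP
  have hmult : ∀ r ∈ T, multiplicity (sectionIdeal B p q) (pt r) = m + 1 := by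
    intro r hr
    have hprime : (pt r).IsPrime := (pointIdeal_isMaximal _).isPrime
    rw [multiplicity, dif_pos hprime]
    have := length_quotient_eq_of_maximalIdeal
      ((sectionIdeal B p q).map (algebraMap (CubeRing 2) (Localization.AtPrime (pt r))))
      (algebraMap (CubeRing 2) (Localization.AtPrime (pt r))
        (MvPolynomial.X 0 - MvPolynomial.C r)) m ?_ ?_ ?_
    · rw [this]; rfl
    · rw [← Localization.AtPrime.map_eq_maximalIdeal, ← Set.image_singleton, ← Ideal.map_span,
        ← Ideal.map_sup]
      congr 1
      refine le_antisymm (sup_le (hle r hr) ?_) ?_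
      · rw [Ideal.span_le, Set.singleton_subset_iff]; exact hX r
      · exact pointIdeal_le (hp r hr) (Ideal.mem_sup_right (Ideal.mem_span_singleton_self _))
          (Ideal.mem_sup_left hlmem)
    · rw [← map_pow, IsLocalization.algebraMap_mem_map_algebraMap_iff (pt r).primeCompl]
      -- The factors of `B` at the other roots are units at this point.
      refine ⟨MvPolynomial.C k *
        ∏ r' ∈ T.erase r, (MvPolynomial.X 0 - MvPolynomial.C r') ^ (m + 1), ?_, ?_⟩
      · intro hmem
        have := mem_pointIdeal.1 hmem
        simp only [map_mul, map_prod, map_pow, map_sub, MvPolynomial.eval_X, MvPolynomial.eval_C,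
          Matrix.cons_val_zero, mul_eq_zero, hk, false_or, Finset.prod_eq_zero_iff] at this
        obtain ⟨r', hr', h0⟩ := this
        exact (Finset.mem_erase.1 hr').1 (sub_eq_zero.1 (pow_eq_zero_iff (by omega) |>.1 h0)).symm
      · rw [mul_assoc, Finset.prod_erase_mul _ _ hr, ← hBX]
        exact hBmem
    · rw [← map_pow, IsLocalization.algebraMap_mem_map_algebraMap_iff (pt r).primeCompl]
      rintro ⟨F, hF, hmem⟩
      -- Test membership on the curve `u₂ = q(u₁) / p(u₁)`, with `1 / p` truncated at order `m + 1`.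
      have hcop : IsCoprime p ((Polynomial.X - Polynomial.C r) ^ (m + 1)) := by
        refine IsCoprime.pow_right (IsCoprime.symm ?_)
        refine ((Polynomial.irreducible_X_sub_C r).coprime_iff_not_dvd).2 ?_
        rw [Polynomial.dvd_iff_isRoot]
        exact hp r hr
      obtain ⟨p', l, hpl⟩ := hcop
      let ψ : CubeRing 2 →ₐ[ℂ] Polynomial ℂ := MvPolynomial.aeval ![Polynomial.X, q * p']
      have hJ : ∀ G ∈ sectionIdeal B p q, (Polynomial.X - Polynomial.C r) ^ (m + 1) ∣ ψ G := by
        have : sectionIdeal B p q ≤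
            (Ideal.span {(Polynomial.X - Polynomial.C r) ^ (m + 1)}).comap ψ := by
          rw [sectionIdeal, Ideal.span_le]
          rintro G (rfl | rfl)
          · rw [SetLike.mem_coe, Ideal.mem_comap, Ideal.mem_span_singleton, hBX]
            simp only [ψ, map_mul, map_prod, map_pow, map_sub, MvPolynomial.aeval_X,
              MvPolynomial.aeval_C, Matrix.cons_val_zero, Polynomial.algebraMap_eq]
            exact dvd_mul_of_dvd_right (Finset.dvd_prod_of_mem
              (fun r' => (Polynomial.X - Polynomial.C r') ^ (m + 1)) hr) _
          · rw [SetLike.mem_coe, Ideal.mem_comap, Ideal.mem_span_singleton, algHom_linForm]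
            simp only [ψ, MvPolynomial.aeval_X, Matrix.cons_val_zero, Matrix.cons_val_one,
              Polynomial.aeval_X_left_apply]
            refine ⟨-(q * l), ?_⟩
            linear_combination q * hpl
        intro G hG
        exact Ideal.mem_span_singleton.1 (this hG)
      have h1 := hJ _ hmem
      have h2 : ψ (MvPolynomial.X 0 - MvPolynomial.C r) = Polynomial.X - Polynomial.C r := by
        simp [ψ]
      rw [map_mul, map_pow, h2, pow_succ', mul_dvd_mul_iff_right
        (pow_ne_zero _ (Polynomial.X_sub_C_ne_zero r)), Polynomial.dvd_iff_isRoot] at h1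
      refine hF (mem_pointIdeal.2 ?_)
      have h3 : p'.eval r * p.eval r = 1 := by
        have := congrArg (Polynomial.eval r) hpl
        simpa using this
      have h4 : ((Polynomial.aeval r).comp ψ : CubeRing 2 →ₐ[ℂ] ℂ) =
          MvPolynomial.aeval ![r, q.eval r / p.eval r] := by
        ext i
        fin_cases i
        · simp [ψ]
        · simp [ψ, eq_div_iff (hp r hr), mul_assoc, h3]
      have h5 := congrArg (fun χ => χ F) h4
      simp only [AlgHom.comp_apply, Polynomial.coe_aeval_eq_eval, MvPolynomial.aeval_eq_eval] at h5
      exact h5.symm.trans h1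
  rw [schemeCycle, hmin, finsum_mem_coe_finset, Finset.sum_image
    (fun r _ r' _ h => hinj r r' h.le)]
  exact Finset.sum_congr rfl fun r hr => by rw [hmult r hr]

/-! ### The boundary of a curve -/

theorem map_facetHom_zero (p q p' q' : Polynomial ℂ) (e : Bool) :
    (curveIdeal p q p' q').map (facetHom 0 e) = Ideal.span
      {MvPolynomial.C (p.eval (facetValue e)) * MvPolynomial.X 0 -
          MvPolynomial.C (q.eval (facetValue e)),
        MvPolynomial.C (p'.eval (facetValue e)) * MvPolynomial.X 1 -
          MvPolynomial.C (q'.eval (facetValue e))} := by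
  have h0 : facetHom (0 : Fin 3) e (MvPolynomial.X 0) = MvPolynomial.C (facetValue e) := by
    simp [facetHom]
  have h1 : facetHom (0 : Fin 3) e (MvPolynomial.X 1) = MvPolynomial.X 0 := by
    simp [facetHom]
  have h2 : facetHom (0 : Fin 3) e (MvPolynomial.X 2) = MvPolynomial.X 1 := by
    simp [facetHom]; rfl
  have hC : ∀ r : Polynomial ℂ, Polynomial.aeval
      (MvPolynomial.C (facetValue e) : CubeRing 2) r = MvPolynomial.C (r.eval (facetValue e)) :=
    fun r => by
      rw [← MvPolynomial.algebraMap_eq, Polynomial.aeval_algebraMap_apply,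
        Polynomial.coe_aeval_eq_eval]
  rw [curveIdeal, Ideal.map_span, Set.image_pair, algHom_linForm, algHom_linForm, h0, h1, h2,
    hC, hC, hC, hC]

theorem map_facetHom_one (p q p' q' : Polynomial ℂ) (e : Bool) :
    (curveIdeal p q p' q').map (facetHom 1 e) =
      sectionIdeal (Polynomial.C (facetValue e) * p - q) p' q' := by
  have h0 : facetHom (1 : Fin 3) e (MvPolynomial.X 0) = MvPolynomial.X 0 := by
    simp [facetHom]; rfl
  have h1 : facetHom (1 : Fin 3) e (MvPolynomial.X 1) = MvPolynomial.C (facetValue e) := by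
    simp [facetHom]
  have h2 : facetHom (1 : Fin 3) e (MvPolynomial.X 2) = MvPolynomial.X 1 := by
    simp [facetHom]; rfl
  rw [curveIdeal, Ideal.map_span, Set.image_pair, algHom_linForm, algHom_linForm, h0, h1, h2,
    sectionIdeal, linForm]
  simp [MvPolynomial.algebraMap_eq, mul_comm]

theorem map_facetHom_two (p q p' q' : Polynomial ℂ) (e : Bool) :
    (curveIdeal p q p' q').map (facetHom 2 e) =
      sectionIdeal (Polynomial.C (facetValue e) * p' - q') p q := by
  have h0 : facetHom (2 : Fin 3) e (MvPolynomial.X 0) = MvPolynomial.X 0 := by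
    simp [facetHom]; rfl
  have h1 : facetHom (2 : Fin 3) e (MvPolynomial.X 1) = MvPolynomial.X 1 := by
    simp [facetHom]; rfl
  have h2 : facetHom (2 : Fin 3) e (MvPolynomial.X 2) = MvPolynomial.C (facetValue e) := by
    simp [facetHom]
  rw [curveIdeal, Ideal.map_span, Set.image_pair, algHom_linForm, algHom_linForm, h0, h1, h2,
    sectionIdeal, linForm, Set.pair_comm]
  simp [MvPolynomial.algebraMap_eq, mul_comm]

/-- The boundary of a curve whose points at `u₁ = 0` and `u₁ = 1` agree: the contributions of the
first coordinate cancel. -/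
theorem boundary_curveIdeal {p q p' q' : Polynomial ℂ}
    (hp : p.eval 0 = p.eval 1) (hq : q.eval 0 = q.eval 1)
    (hp' : p'.eval 0 = p'.eval 1) (hq' : q'.eval 0 = q'.eval 1) :
    boundary 2 (Finsupp.single (curveIdeal p q p' q') 1) =
      schemeCycle (sectionIdeal (p - q) p' q') - schemeCycle (sectionIdeal (-q) p' q') +
      (schemeCycle (sectionIdeal (-q') p q) - schemeCycle (sectionIdeal (p' - q') p q)) := by
  have hr : ∀ (i : Fin 3) (e : Bool), facetRestriction i e
      (Finsupp.single (curveIdeal p q p' q') 1) =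
        schemeCycle ((curveIdeal p q p' q').map (facetHom i e)) := by
    intro i e
    simp [facetRestriction]
  simp only [boundary, LinearMap.sum_apply, LinearMap.smul_apply, LinearMap.sub_apply, hr]
  rw [Fin.sum_univ_three]
  simp only [map_facetHom_zero, map_facetHom_one, map_facetHom_two, facetValue]
  simp [hp, hq, hp', hq']

theorem schemeCycle_sectionIdeal_const {k : ℂ} (hk : k ≠ 0) {B p q : Polynomial ℂ}
    (hB : B = Polynomial.C k) : schemeCycle (sectionIdeal B p q) = 0 := by
  rw [schemeCycle_sectionIdeal ∅ 0 hk (by simpa using hB) (by simp), Finset.sum_empty]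


/-! ### The functions on the normalization of the nodal fibre -/

open Polynomial in
/-- The polynomial `x + 2/3 + j y` in `u = z / (z - 1)`, where `x = 4u(u - 1)` and
`y = 4u(u - 1)(2u - 1)`. -/
def nodalCubic (j : ℂ) : Polynomial ℂ :=
  C (2 / 3) + 4 * X * (X - 1) + 4 * C j * X * (X - 1) * (2 * X - 1)

/-- The function `a` on the nodal fibre. -/
def polyA : Polynomial ℂ := nodalCubic Complex.I

/-- The function `c = -b` on the nodal fibre. -/
def polyC : Polynomial ℂ := nodalCubic (-Complex.I)

theorem eval_nodalCubic (j s : ℂ) : (nodalCubic j).eval s =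
    2 / 3 + 4 * s * (s - 1) + 4 * j * s * (s - 1) * (2 * s - 1) := by simp [nodalCubic]

theorem eval_derivative_nodalCubic (j s : ℂ) : (Polynomial.derivative (nodalCubic j)).eval s =
    8 * s - 4 + 4 * j * (6 * s ^ 2 - 6 * s + 1) := by
  simp [nodalCubic]; ring

theorem eval_polyA (s : ℂ) : polyA.eval s =
    2 / 3 + 4 * s * (s - 1) + 4 * Complex.I * s * (s - 1) * (2 * s - 1) := eval_nodalCubic _ _

theorem eval_polyC (s : ℂ) : polyC.eval s =
    2 / 3 + 4 * s * (s - 1) - 4 * Complex.I * s * (s - 1) * (2 * s - 1) := by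
  rw [polyC, eval_nodalCubic]; ring

/-- On the nodal fibre `((a + c) / 2)³ = a c - 4 / 27`. -/
theorem eval_polyA_polyC_relation (s : ℂ) : (polyA.eval s + polyC.eval s) ^ 3 =
    8 * polyA.eval s * polyC.eval s - 32 / 27 := by
  rw [eval_polyA, eval_polyC]
  linear_combination (128 * s ^ 2 * (s - 1) ^ 2 * (2 * s - 1) ^ 2) * Complex.I_sq

theorem polyA_polyC_relation : (polyA + polyC) ^ 3 = 8 * polyA * polyC - Polynomial.C (32 / 27) :=
  Polynomial.funext fun s => by simpa using eval_polyA_polyC_relation s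

theorem nodalCubic_ne_zero (j : ℂ) : nodalCubic j ≠ 0 := fun h => by
  have := eval_nodalCubic j 0
  norm_num [h] at this

/-- The cubics are separable.  In terms of `w = j (2u - 1)` the cubic is `-(2w³ + (w + 1)³) / 3`. -/
theorem nodalCubic_eq_prod {j : ℂ} (hj : j ^ 2 = -1) : ∃ k : ℂ, k ≠ 0 ∧
    nodalCubic j = Polynomial.C k *
      ∏ r ∈ (nodalCubic j).roots.toFinset, (Polynomial.X - Polynomial.C r) := by
  classical
  have hne := nodalCubic_ne_zero j
  refine ⟨(nodalCubic j).leadingCoeff, by simpa using hne, ?_⟩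
  have hnodup : (nodalCubic j).roots.Nodup := by
    rw [Multiset.nodup_iff_count_le_one]
    intro s
    rw [Polynomial.count_roots]
    by_contra! hlt
    obtain ⟨h1, h2⟩ := (Polynomial.one_lt_rootMultiplicity_iff_isRoot hne).1 hlt
    rw [Polynomial.IsRoot, eval_nodalCubic] at h1
    rw [Polynomial.IsRoot, eval_derivative_nodalCubic] at h2
    set w := j * (2 * s - 1) with hw
    have hw2 : w ^ 2 = -(2 * s - 1) ^ 2 := by rw [hw, mul_pow, hj]; ring
    have h3 : 2 * w ^ 3 + (w + 1) ^ 3 = 0 := by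
      rw [show 2 * w ^ 3 + (w + 1) ^ 3 = 3 * w * w ^ 2 + 3 * w ^ 2 + 3 * w + 1 by ring, hw2, hw]
      linear_combination (-3) * h1
    have h4 : 2 * w ^ 2 + (w + 1) ^ 2 = 0 := by
      rw [show 2 * w ^ 2 + (w + 1) ^ 2 = 3 * w ^ 2 + 2 * w + 1 by ring, hw2, hw]
      linear_combination (j / 2) * h2 - 2 * (6 * s ^ 2 - 6 * s + 1) * hj
    have h5 : w ^ 2 = 0 := by linear_combination (w + 1) / 2 * h4 - h3 / 2
    have h6 : w = 0 := by simpa using h5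
    simp [h6] at h4
  have := (IsAlgClosed.splits (nodalCubic j)).eq_prod_roots
  rw [Finset.prod, Multiset.toFinset_val, hnodup.dedup]
  exact this

open Polynomial in
theorem isCoprime_sub_polyC : IsCoprime (polyC - polyA) polyC := by
  have h1 : (C (-(27 / 32)) : Polynomial ℂ) * C (32 / 27) = -1 := by
    rw [← C_mul]; norm_num
  refine ⟨C (27 / 32) * (polyC - polyA) ^ 2, C (-(27 / 32)) * (8 * polyC ^ 2 -
    12 * polyC * (polyC - polyA) + 6 * (polyC - polyA) ^ 2 - 8 * polyC +
    8 * (polyC - polyA)), ?_⟩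
  have h2 : (C (27 / 32) : Polynomial ℂ) = - C (-(27 / 32)) := by rw [← C_neg]; norm_num
  rw [h2]
  linear_combination C (-(27 / 32)) * polyA_polyC_relation - h1

/-- The constant `k = -4i/27`, the common value of `i c³/8` at the zeros of `a` and of `i a³/8` at
the zeros of `c`. -/
def kConst : ℂ := -(4 * Complex.I) / 27

/-- The value of the coordinate `u` at `z = -4i/27`. -/
def kappa : ℂ := kConst / (kConst - 1)

open Polynomial in
/-- `i h³ / 8`. -/
def cubePoly (h : Polynomial ℂ) : Polynomial ℂ := C (Complex.I / 8) * h ^ 3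

theorem eval_cubePoly (h : Polynomial ℂ) (s : ℂ) :
    (cubePoly h).eval s = Complex.I / 8 * (h.eval s) ^ 3 := by simp [cubePoly]

theorem kConst_re : kConst.re = 0 := by simp [kConst]
theorem kConst_im : kConst.im = -(4 / 27) := by
  simp only [kConst, Complex.div_im, Complex.neg_im, Complex.mul_im]; norm_num

theorem kConst_ne_one : kConst ≠ 1 := fun h => by
  have := kConst_re
  simp [h] at this

theorem kConst_ne_zero : kConst ≠ 0 := fun h => by
  have := kConst_im
  norm_num [h] at this

theorem kappa_ne_zero : kappa ≠ 0 := div_ne_zero kConst_ne_zero (sub_ne_zero.2 kConst_ne_one)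

theorem kappa_ne_one : kappa ≠ 1 := fun h => by
  rw [kappa, div_eq_one_iff_eq (sub_ne_zero.2 kConst_ne_one)] at h
  exact one_ne_zero (sub_eq_self.1 h.symm)

theorem cubePoly_polyC_of_root {r : ℂ} (h : polyA.eval r = 0) :
    (cubePoly polyC).eval r = kConst := by
  have := eval_polyA_polyC_relation r
  rw [h] at this
  rw [eval_cubePoly, kConst]
  linear_combination Complex.I / 8 * this

theorem cubePoly_polyA_of_root {r : ℂ} (h : polyC.eval r = 0) :
    (cubePoly polyA).eval r = kConst := by
  have := eval_polyA_polyC_relation r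
  rw [h] at this
  rw [eval_cubePoly, kConst]
  linear_combination Complex.I / 8 * this

/-- The curve `(z, i a³/8, i c³/8)`. -/
def cubeCurve : Ideal (CubeRing 3) :=
  curveIdeal (cubePoly polyA - 1) (cubePoly polyA) (cubePoly polyC - 1) (cubePoly polyC)

/-- The curve `(z, c/a, -4i/27)`. -/
def quotientCurve : Ideal (CubeRing 3) :=
  curveIdeal (polyC - polyA) polyC 1 (Polynomial.C kappa)

open Polynomial in
theorem neg_cubePoly_eq_prod {j : ℂ} (hj : j ^ 2 = -1) : ∃ k : ℂ, k ≠ 0 ∧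
    -cubePoly (nodalCubic j) = C k * ∏ r ∈ (nodalCubic j).roots.toFinset, (X - C r) ^ (2 + 1) := by
  obtain ⟨k, hk, h⟩ := nodalCubic_eq_prod hj
  refine ⟨-(Complex.I / 8) * k ^ 3, mul_ne_zero (by simp) (pow_ne_zero _ hk), ?_⟩
  rw [Finset.prod_pow, cubePoly]
  nth_rewrite 1 [h]
  simp only [map_mul, map_neg, map_pow]
  ring

open Polynomial in
theorem neg_nodalCubic_eq_prod {j : ℂ} (hj : j ^ 2 = -1) : ∃ k : ℂ, k ≠ 0 ∧
    -nodalCubic j = C k * ∏ r ∈ (nodalCubic j).roots.toFinset, (X - C r) ^ (0 + 1) := by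
  obtain ⟨k, hk, h⟩ := nodalCubic_eq_prod hj
  refine ⟨-k, neg_ne_zero.2 hk, ?_⟩
  nth_rewrite 1 [h]
  simp

theorem boundary_cubeCurve : boundary 2 (Finsupp.single cubeCurve 1) =
    ∑ r ∈ polyC.roots.toFinset, Finsupp.single (pointIdeal ![r, kappa]) 3 -
      ∑ r ∈ polyA.roots.toFinset, Finsupp.single (pointIdeal ![r, kappa]) 3 := by
  have h01 : ∀ j, (nodalCubic j).eval 0 = (nodalCubic j).eval 1 := by simp [eval_nodalCubic]
  have hA : (cubePoly polyA).eval 0 = (cubePoly polyA).eval 1 := by simp [eval_cubePoly, polyA, h01]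
  have hC : (cubePoly polyC).eval 0 = (cubePoly polyC).eval 1 := by simp [eval_cubePoly, polyC, h01]
  obtain ⟨kA, hkA, eA⟩ : ∃ k : ℂ, k ≠ 0 ∧ -cubePoly polyA = Polynomial.C k *
      ∏ r ∈ polyA.roots.toFinset, (Polynomial.X - Polynomial.C r) ^ (2 + 1) :=
    neg_cubePoly_eq_prod Complex.I_sq
  obtain ⟨kC, hkC, eC⟩ : ∃ k : ℂ, k ≠ 0 ∧ -cubePoly polyC = Polynomial.C k *
      ∏ r ∈ polyC.roots.toFinset, (Polynomial.X - Polynomial.C r) ^ (2 + 1) :=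
    neg_cubePoly_eq_prod (by simp)
  have rA : ∀ r ∈ polyA.roots.toFinset, (cubePoly polyC).eval r = kConst :=
    fun r hr => cubePoly_polyC_of_root (Polynomial.isRoot_of_mem_roots (Multiset.mem_toFinset.1 hr))
  have rC : ∀ r ∈ polyC.roots.toFinset, (cubePoly polyA).eval r = kConst :=
    fun r hr => cubePoly_polyA_of_root (Polynomial.isRoot_of_mem_roots (Multiset.mem_toFinset.1 hr))
  have h1 := sub_ne_zero.2 kConst_ne_one
  rw [cubeCurve, boundary_curveIdeal (by simp [hA]) hA (by simp [hC]) hC,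
    schemeCycle_sectionIdeal_const (k := -1) (by simp) (by simp),
    schemeCycle_sectionIdeal_const (B := cubePoly polyC - 1 - _) (k := -1) (by simp) (by simp),
    schemeCycle_sectionIdeal _ 2 hkA eA (fun r hr => by simpa [rA r hr] using h1),
    schemeCycle_sectionIdeal _ 2 hkC eC (fun r hr => by simpa [rC r hr] using h1),
    zero_sub, sub_zero, neg_add_eq_sub]
  congr 1
  · exact Finset.sum_congr rfl fun r hr => by simp [rC r hr, kappa]
  · exact Finset.sum_congr rfl fun r hr => by simp [rA r hr, kappa]

theorem boundary_quotientCurve : boundary 2 (Finsupp.single quotientCurve 1) =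
    ∑ r ∈ polyA.roots.toFinset, Finsupp.single (pointIdeal ![r, kappa]) 1 -
      ∑ r ∈ polyC.roots.toFinset, Finsupp.single (pointIdeal ![r, kappa]) 1 := by
  have h01 : ∀ j, (nodalCubic j).eval 0 = (nodalCubic j).eval 1 := by simp [eval_nodalCubic]
  obtain ⟨kA, hkA, eA⟩ : ∃ k : ℂ, k ≠ 0 ∧ -polyA = Polynomial.C k *
      ∏ r ∈ polyA.roots.toFinset, (Polynomial.X - Polynomial.C r) ^ (0 + 1) :=
    neg_nodalCubic_eq_prod Complex.I_sq
  obtain ⟨kC, hkC, eC⟩ : ∃ k : ℂ, k ≠ 0 ∧ -polyC = Polynomial.C k *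
      ∏ r ∈ polyC.roots.toFinset, (Polynomial.X - Polynomial.C r) ^ (0 + 1) :=
    neg_nodalCubic_eq_prod (by simp)
  have e : polyC - polyA - polyC = -polyA := by ring
  rw [quotientCurve, boundary_curveIdeal (by simp [polyA, polyC, h01]) (by simp [polyC, h01])
      (by simp) (by simp), e,
    schemeCycle_sectionIdeal _ 0 hkA eA (fun r hr => by simp),
    schemeCycle_sectionIdeal _ 0 hkC eC (fun r hr => by simp),
    schemeCycle_sectionIdeal_const (k := -kappa) (neg_ne_zero.2 kappa_ne_zero) (by simp),
    schemeCycle_sectionIdeal_const (k := 1 - kappa) (sub_ne_zero.2 kappa_ne_one.symm) (by simp),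
    sub_zero, add_zero]
  simp

theorem boundary_cubeCurve_add_quotientCurve :
    boundary 2 (Finsupp.single cubeCurve 1 + (3 : ℚ) • Finsupp.single quotientCurve 1) = 0 := by
  rw [map_add, map_smul, boundary_cubeCurve, boundary_quotientCurve, smul_sub, Finset.smul_sum,
    Finset.smul_sum]
  simp

theorem transcendental_uCoord : Transcendental ℂ (uCoord RatFunc.X) := by
  refine RatFunc.transcendental_of_ne_C _ ?_
  rintro ⟨c, hc⟩
  rw [uCoord, div_eq_iff X_sub_one_ne_zero] at hc
  have h1 : algebraMap (Polynomial ℂ) FunField Polynomial.X =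
      algebraMap (Polynomial ℂ) FunField (Polynomial.C c * (Polynomial.X - 1)) := by
    simpa using hc
  have h2 := RatFunc.algebraMap_injective ℂ h1
  have h3 := congrArg (Polynomial.eval 1) h2
  simp at h3

theorem graphIdeal_eq_curveIdeal {f g : FunField} {p q p' q' : Polynomial ℂ} (hp : p ≠ 0)
    (hp' : p' ≠ 0) (h : IsCoprime p q) (h' : IsCoprime p' q')
    (hf : uCoord f = Polynomial.aeval (uCoord RatFunc.X) q / Polynomial.aeval (uCoord RatFunc.X) p)
    (hg : uCoord g =
      Polynomial.aeval (uCoord RatFunc.X) q' / Polynomial.aeval (uCoord RatFunc.X) p') :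
    graphIdeal f g = curveIdeal p q p' q' := by
  rw [graphIdeal, hf, hg, ker_aeval_eq_curveIdeal transcendental_uCoord hp hp' h h']

theorem xNodal_eq : xNodal = 4 * uCoord RatFunc.X * (uCoord RatFunc.X - 1) := by
  have h := X_sub_one_ne_zero
  unfold xNodal uCoord
  field_simp
  ring

theorem yNodal_eq : yNodal =
    4 * uCoord RatFunc.X * (uCoord RatFunc.X - 1) * (2 * uCoord RatFunc.X - 1) := by
  have h := X_sub_one_ne_zero
  unfold yNodal uCoord
  field_simp
  ring

theorem restrictNodal_unitA : restrictNodal unitA = Polynomial.aeval (uCoord RatFunc.X) polyA := by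
  have : restrictNodal unitA = restrictSurface fnA := by
    rw [restrictNodal]
    exact IsLocalization.Away.lift_eq _ _ _
  rw [this]
  simp only [fnA, map_add, map_mul, restrictSurface_coord, restrictSurface_const]
  simp only [polyA, nodalCubic, map_add, map_sub, map_mul, map_ofNat, map_one,
    Polynomial.aeval_C, Polynomial.aeval_X, Matrix.cons_val_zero, Matrix.cons_val_one, xNodal_eq,
    yNodal_eq]
  ring

theorem restrictNodal_unitB :
    -restrictNodal unitB = Polynomial.aeval (uCoord RatFunc.X) polyC := by
  have : restrictNodal unitB = restrictSurface fnB := by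
    rw [restrictNodal]
    exact IsLocalization.Away.lift_eq _ _ _
  rw [this]
  simp only [fnB, map_sub, map_mul, restrictSurface_coord, restrictSurface_const]
  simp only [polyC, nodalCubic, map_add, map_sub, map_mul, map_ofNat, map_one, map_neg,
    Polynomial.aeval_C, Polynomial.aeval_X, Matrix.cons_val_zero, Matrix.cons_val_one, xNodal_eq,
    yNodal_eq]
  ring

/-! ### Symbols -/

theorem symbol_mul_left {R : Type} [CommRing R] (f f' g : Rˣ) :
    symbol (f * f') g = symbol f g + symbol f' g := by
  simp [symbol, TensorProduct.add_tmul, TensorProduct.tmul_add]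

theorem symbol_mul_right {R : Type} [CommRing R] (f g g' : Rˣ) :
    symbol f (g * g') = symbol f g + symbol f g' := by
  simp [symbol, TensorProduct.tmul_add]

theorem symbol_eq_zero_left {R : Type} [CommRing R] {ε : Rˣ} (hε : ε ^ 4 = 1) (g : Rˣ) :
    symbol ε g = 0 := by
  have h1 : symbol (1 : Rˣ) g = 0 := by simpa using symbol_mul_left 1 1 g
  rw [← hε, show ε ^ 4 = ε * ε * (ε * ε) by simp [pow_succ, mul_assoc], symbol_mul_left,
    symbol_mul_left] at h1
  have h4 : (4 : ℚ) • symbol ε g = 0 := by rw [← h1]; module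
  exact (smul_eq_zero.1 h4).resolve_left (by norm_num)

theorem symbol_eq_zero_right {R : Type} [CommRing R] {ε : Rˣ} (hε : ε ^ 4 = 1) (f : Rˣ) :
    symbol f ε = 0 := by
  have h1 : symbol f (1 : Rˣ) = 0 := by simpa using symbol_mul_right f 1 1
  rw [← hε, show ε ^ 4 = ε * ε * (ε * ε) by simp [pow_succ, mul_assoc], symbol_mul_right,
    symbol_mul_right] at h1
  have h4 : (4 : ℚ) • symbol f ε = 0 := by rw [← h1]; module
  exact (smul_eq_zero.1 h4).resolve_left (by norm_num)

/-- Roots of unity do not affect symbols with rational coefficients. -/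
theorem symbol_mul_mul {R : Type} [CommRing R] {ε ε' : Rˣ} (hε : ε ^ 4 = 1) (hε' : ε' ^ 4 = 1)
    (f g : Rˣ) : symbol (ε * f) (ε' * g) = symbol f g := by
  rw [symbol_mul_left, symbol_eq_zero_left hε, zero_add, symbol_mul_right,
    symbol_eq_zero_right hε', zero_add]

theorem Symbols.map_smul_symbol {R S : Type} [CommRing R] [CommRing S] (φ : R →+* S) (r : ℚ)
    (f g : Rˣ) : Symbols.map φ (r • symbol f g) =
      r • symbol (Units.map (φ : R →* S) f) (Units.map (φ : R →* S) g) := by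
  simp only [symbol, Symbols.map, TensorProduct.smul_tmul', smul_eq_mul, mul_one]
  exact TensorProduct.map_tmul _ _ _ _

theorem restrictNodal_algebraMap (F : SurfaceRing) :
    restrictNodal (algebraMap SurfaceRing OpenRing F) = restrictSurface F := by
  rw [restrictNodal]
  exact IsLocalization.Away.lift_eq _ _ _

theorem restrictNodal_unitConst (c : ℂ) (hc : c ≠ 0) :
    Units.map (restrictNodal : OpenRing →* FunField) (unitConst OpenRing c hc) =
      unitConst FunField c hc := by
  ext
  change restrictNodal (algebraMap ℂ OpenRing c) = algebraMap ℂ FunField c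
  rw [IsScalarTower.algebraMap_apply ℂ SurfaceRing OpenRing, restrictNodal_algebraMap]
  exact restrictSurface_const c

theorem restrictNodal_unitD : Units.map (restrictNodal : OpenRing →* FunField) unitD =
    unitConst FunField (-(4 / 27)) (by norm_num) := by
  ext
  change restrictNodal (algebraMap SurfaceRing OpenRing fnD) = algebraMap ℂ FunField _
  rw [restrictNodal_algebraMap]
  simp only [fnD, map_sub, map_neg, restrictSurface_coord, restrictSurface_const]
  simp

theorem symbolSum_nodalPairs :
    symbolSum nodalPairs = Symbols.map restrictNodal xiTwo := by
  rw [symbolSum, nodalPairs]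
  refine (Finsupp.sum_add_index' (h := fun (fg : FunFieldˣ × FunFieldˣ) (r : ℚ) =>
    r • symbol fg.1 fg.2) (fun _ => zero_smul ℚ _) (fun _ _ _ => add_smul _ _ _)).trans ?_
  simp only [Finsupp.sum_single_index, zero_smul]
  rw [xiTwo, map_add, Symbols.map_smul_symbol, ← one_smul ℚ (symbol (unitA ^ 3 / _) _),
    Symbols.map_smul_symbol]
  simp only [map_div, map_pow, restrictNodal_unitConst, restrictNodal_unitD]
  set a : FunFieldˣ := Units.map (restrictNodal : OpenRing →* FunField) unitA
  set b : FunFieldˣ := Units.map (restrictNodal : OpenRing →* FunField) unitB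
  have hI : unitConst FunField Complex.I (by simp) ^ 4 = 1 := by
    ext
    simp [unitConst, ← map_pow]
  have hI' : (-unitConst FunField Complex.I (by simp)) ^ 4 = 1 := by
    rw [Even.neg_pow (by decide), hI]
  have hm : (-1 : FunFieldˣ) ^ 4 = 1 := by norm_num
  congr 2
  · rw [← symbol_mul_mul hI hI' (a ^ 3 / _) (b ^ 3 / _)]
    congr 1
    · ext; simp [unitConst]; ring
    · ext; simp [unitConst]; ring
  · rw [← symbol_mul_mul hm hI (b / a) _]
    congr 1
    · ext; simp [neg_div]
    · ext; simp [unitConst]; ring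

theorem rationalTwist_eq : rationalTwist = Submodule.span ℚ {(Real.pi : ℂ) ^ 2} := by
  have h : (2 * Real.pi * Complex.I : ℂ) ^ 2 = (-4 : ℚ) • (Real.pi : ℂ) ^ 2 := by
    rw [mul_pow, Complex.I_sq, Rat.smul_def]; push_cast; ring
  rw [rationalTwist, h]
  exact Submodule.span_singleton_smul_eq (isUnit_iff_ne_zero.2 (by norm_num)) _

/-! ### The cycle and its boundary -/

theorem cubePoly_sub_one_ne_zero (j : ℂ) : cubePoly (nodalCubic j) - 1 ≠ 0 := fun h => by
  have h1 := congrArg (Polynomial.eval 0) h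
  simp only [Polynomial.eval_sub, eval_cubePoly, eval_nodalCubic, Polynomial.eval_one,
    Polynomial.eval_zero] at h1
  have := congrArg Complex.re h1
  norm_num at this

theorem polyC_sub_polyA_ne_zero : polyC - polyA ≠ 0 := fun h => by
  have h1 := congrArg (Polynomial.eval 2) h
  simp only [Polynomial.eval_sub, eval_polyA, eval_polyC, Polynomial.eval_zero] at h1
  have := congrArg Complex.im h1
  norm_num at this

theorem isCoprime_sub_one (p : Polynomial ℂ) : IsCoprime (p - 1) p := ⟨-1, 1, by ring⟩

theorem cubePoly_eval_facet (j : ℂ) {s : ℂ} (hs : s = 0 ∨ s = 1) :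
    (cubePoly (nodalCubic j)).eval s = Complex.I / 27 := by
  rw [eval_cubePoly, eval_nodalCubic]
  rcases hs with rfl | rfl <;> ring

theorem mem_points_cubeCurve {x : Fin 3 → ℂ} : x ∈ points cubeCurve ↔
    ((cubePoly polyA).eval (x 0) - 1) * x 1 = (cubePoly polyA).eval (x 0) ∧
    ((cubePoly polyC).eval (x 0) - 1) * x 2 = (cubePoly polyC).eval (x 0) := by
  rw [cubeCurve, mem_points_curveIdeal]; simp

theorem mem_points_quotientCurve {x : Fin 3 → ℂ} : x ∈ points quotientCurve ↔
    (polyC.eval (x 0) - polyA.eval (x 0)) * x 1 = polyC.eval (x 0) ∧ x 2 = kappa := by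
  rw [quotientCurve, mem_points_curveIdeal]; simp

theorem isAdmissible_cubeCurve : IsAdmissible 2 cubeCurve := by
  refine isAdmissible_curveIdeal (cubePoly_sub_one_ne_zero _) (cubePoly_sub_one_ne_zero _)
    (isCoprime_sub_one _) (isCoprime_sub_one _) ?_ ?_
  · intro x hx i j hij hi hj
    obtain ⟨h1, h2⟩ := mem_points_cubeCurve.1 hx
    have n1 : x 1 ≠ 1 := fun h => by rw [h] at h1; simp at h1
    have n2 : x 2 ≠ 1 := fun h => by rw [h] at h2; simp at h2
    have hI27 : Complex.I / 27 ≠ 0 := by simp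
    have h01 : x 0 = 0 ∨ x 0 = 1 → x 1 ≠ 0 ∧ x 2 ≠ 0 := by
      intro h
      rw [polyA, cubePoly_eval_facet _ h] at h1
      rw [polyC, cubePoly_eval_facet _ h] at h2
      constructor
      · intro h0; rw [h0, mul_zero] at h1; exact hI27 h1.symm
      · intro h0; rw [h0, mul_zero] at h2; exact hI27 h2.symm
    have h12 : x 1 = 0 → x 2 ≠ 0 := by
      intro h0 h0'
      rw [h0, mul_zero, eval_cubePoly] at h1
      rw [h0', mul_zero, cubePoly_polyC_of_root (by simpa using h1.symm)] at h2
      exact kConst_ne_zero h2.symm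
    fin_cases i <;> fin_cases j <;> simp at hij hi hj <;> simp_all
  · have hA : (cubePoly polyA).eval (1 / 2) = -Complex.I / 216 := by
      rw [eval_cubePoly, eval_polyA]; ring
    have hC : (cubePoly polyC).eval (1 / 2) = -Complex.I / 216 := by
      rw [eval_cubePoly, eval_polyC]; ring
    have h1 : -Complex.I / 216 - 1 ≠ 0 := fun h => by
      have := congrArg Complex.re h
      norm_num at this
    refine ⟨![1 / 2, (cubePoly polyA).eval (1 / 2) / ((cubePoly polyA).eval (1 / 2) - 1),
      (cubePoly polyC).eval (1 / 2) / ((cubePoly polyC).eval (1 / 2) - 1)], ?_, ?_⟩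
    · refine mem_points_cubeCurve.2 ?_
      simp only [Matrix.cons_val]
      rw [hA, hC]
      exact ⟨mul_div_cancel₀ _ h1, mul_div_cancel₀ _ h1⟩
    · rw [hA, hC]
      have h2 : -Complex.I / 216 / (-Complex.I / 216 - 1) ≠ 1 := fun h => by
        rw [div_eq_one_iff_eq h1] at h
        exact one_ne_zero (sub_eq_self.1 h.symm)
      have h3 : -Complex.I / 216 / (-Complex.I / 216 - 1) ≠ 0 := div_ne_zero (by simp) h1
      intro i
      fin_cases i <;> simp [h2, h3]

theorem isAdmissible_quotientCurve : IsAdmissible 2 quotientCurve := by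
  refine isAdmissible_curveIdeal polyC_sub_polyA_ne_zero one_ne_zero isCoprime_sub_polyC
    isCoprime_one_left ?_ ?_
  · intro x hx i j hij hi hj
    obtain ⟨h1, h2⟩ := mem_points_quotientCurve.1 hx
    have h3 := kappa_ne_zero
    have h4 := kappa_ne_one
    have h01 : ¬ (x 0 = 0 ∨ x 0 = 1) := by
      rintro (h | h) <;> rw [h, eval_polyA, eval_polyC] at h1 <;> norm_num at h1
    fin_cases i <;> fin_cases j <;> simp at hij hi hj <;> simp_all
  · have hA : polyA.eval (1 / 4) = -1 / 12 + 3 * Complex.I / 8 := by rw [eval_polyA]; ring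
    have hC : polyC.eval (1 / 4) = -1 / 12 - 3 * Complex.I / 8 := by rw [eval_polyC]; ring
    have h1 : polyC.eval (1 / 4) - polyA.eval (1 / 4) ≠ 0 := fun h => by
      rw [hA, hC] at h
      have := congrArg Complex.im h
      norm_num at this
    refine ⟨![1 / 4, polyC.eval (1 / 4) / (polyC.eval (1 / 4) - polyA.eval (1 / 4)), kappa],
      ?_, ?_⟩
    · refine mem_points_quotientCurve.2 ?_
      simp only [Matrix.cons_val, and_true]
      exact mul_div_cancel₀ _ h1
    · have h2 : polyC.eval (1 / 4) / (polyC.eval (1 / 4) - polyA.eval (1 / 4)) ≠ 1 := fun h => by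
        rw [div_eq_one_iff_eq h1, eq_comm, sub_eq_self, hA] at h
        have := congrArg Complex.re h
        norm_num at this
      have h3 : polyC.eval (1 / 4) / (polyC.eval (1 / 4) - polyA.eval (1 / 4)) ≠ 0 := by
        refine div_ne_zero (fun h => ?_) h1
        rw [hC] at h
        have := congrArg Complex.re h
        norm_num at this
      intro i
      fin_cases i
      · simp
      · exact not_or.2 ⟨h3, h2⟩
      · exact not_or.2 ⟨kappa_ne_zero, kappa_ne_one⟩

theorem aeval_uCoord_injective :
    Function.Injective (Polynomial.aeval (R := ℂ) (uCoord RatFunc.X)) :=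
  transcendental_iff_injective.1 transcendental_uCoord

theorem nodalCycle_eq :
    nodalCycle = Finsupp.single cubeCurve 1 + (3 : ℚ) • Finsupp.single quotientCurve 1 := by
  set a : FunFieldˣ := Units.map (restrictNodal : OpenRing →* FunField) unitA with ha
  set c : FunFieldˣ := -Units.map (restrictNodal : OpenRing →* FunField) unitB with hc
  have va : (a : FunField) = Polynomial.aeval (uCoord RatFunc.X) polyA := restrictNodal_unitA
  have vc : (c : FunField) = Polynomial.aeval (uCoord RatFunc.X) polyC := restrictNodal_unitB
  have hcube : ∀ (h : FunFieldˣ) (p : Polynomial ℂ),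
      (h : FunField) = Polynomial.aeval (uCoord RatFunc.X) p →
      ((unitConst FunField (Complex.I / 8) (by simp) * h ^ 3 : FunFieldˣ) : FunField) =
        Polynomial.aeval (uCoord RatFunc.X) (cubePoly p) := by
    intro h p hp
    simp only [cubePoly, Units.val_mul, Units.val_pow_eq_pow_val, hp, map_mul, map_pow,
      Polynomial.aeval_C]
    rfl
  have hone : ∀ (h : FunFieldˣ) (j : ℂ),
      (h : FunField) = Polynomial.aeval (uCoord RatFunc.X) (cubePoly (nodalCubic j)) → h ≠ 1 := by
    rintro h j hj rfl
    refine cubePoly_sub_one_ne_zero j (aeval_uCoord_injective ?_)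
    rw [map_sub, ← hj]; simp
  have hcub : ∀ (h : FunFieldˣ) (p : Polynomial ℂ),
      (h : FunField) = Polynomial.aeval (uCoord RatFunc.X) p → uCoord h =
        Polynomial.aeval (uCoord RatFunc.X) p / Polynomial.aeval (uCoord RatFunc.X) (p - 1) := by
    intro h p hp
    rw [uCoord, hp, map_sub, map_one]
  have hca : c / a ≠ 1 := by
    rw [Ne, div_eq_one, ← Units.val_inj, va, vc]
    exact fun h => polyC_sub_polyA_ne_zero (sub_eq_zero.2 (aeval_uCoord_injective h))
  have hk : unitConst FunField (-(4 * Complex.I) / 27) (by simp) ≠ 1 := by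
    rw [Ne, ← Units.val_inj]
    intro h
    exact kConst_ne_one ((algebraMap ℂ FunField).injective (h.trans (map_one _).symm))
  have hq : uCoord ((c / a : FunFieldˣ) : FunField) =
      Polynomial.aeval (uCoord RatFunc.X) polyC /
        Polynomial.aeval (uCoord RatFunc.X) (polyC - polyA) := by
    have ha0 : Polynomial.aeval (uCoord RatFunc.X) polyA ≠ 0 := va ▸ a.ne_zero
    have e : uCoord ((c / a : FunFieldˣ) : FunField) =
        (c / a : FunFieldˣ) / ((c / a : FunFieldˣ) - 1) := rfl
    rw [e, Units.val_div_eq_div_val, va, vc, map_sub, div_sub_one ha0,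
      div_div_div_cancel_right₀ ha0]
  have hκ : uCoord ((unitConst FunField (-(4 * Complex.I) / 27) (by simp) : FunFieldˣ) : FunField) =
      Polynomial.aeval (uCoord RatFunc.X) (Polynomial.C kappa) /
        Polynomial.aeval (uCoord RatFunc.X) (1 : Polynomial ℂ) := by
    rw [map_one, div_one, Polynomial.aeval_C, kappa, map_div₀, map_sub, map_one]
    rfl
  rw [nodalCycle, nodalPairs, map_add, graphCycle, Finsupp.linearCombination_single,
    Finsupp.linearCombination_single, one_smul]
  simp only [← ha, ← hc]
  rw [if_neg (not_or.2 ⟨hone _ _ (hcube a _ va), hone _ _ (hcube c _ vc)⟩),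
    if_neg (not_or.2 ⟨hca, hk⟩), cubeCurve, quotientCurve,
    graphIdeal_eq_curveIdeal (cubePoly_sub_one_ne_zero _) (cubePoly_sub_one_ne_zero _)
      (isCoprime_sub_one _) (isCoprime_sub_one _) (hcub _ _ (hcube a _ va))
      (hcub _ _ (hcube c _ vc)),
    graphIdeal_eq_curveIdeal polyC_sub_polyA_ne_zero one_ne_zero isCoprime_sub_polyC
      (isCoprime_one_left (x := Polynomial.C kappa)) hq hκ]
  rfl

theorem nodalCycle_mem_closedCycles : nodalCycle ∈ closedCycles 2 3 := by
  rw [nodalCycle_eq]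
  refine ⟨add_mem ?_ (Submodule.smul_mem _ _ ?_), ?_⟩
  · exact Finsupp.single_mem_supported ℚ _ isAdmissible_cubeCurve
  · exact Finsupp.single_mem_supported ℚ _ isAdmissible_quotientCurve
  · rw [SetLike.mem_coe, Submodule.mem_comap, boundary_cubeCurve_add_quotientCurve]
    exact zero_mem _

open Filter Topology ComplexConjugate

/-! ### Real chains on parametrized curves -/

theorem zCoord_div_sub_one {h : ℂ} (hh : h ≠ 1) : zCoord (h / (h - 1)) = h := by
  have h1 : h - 1 ≠ 0 := sub_ne_zero.2 hh
  rw [zCoord, div_sub_one h1, div_div_div_cancel_right₀ h1]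
  simp

theorem div_sub_one_mem_negAxis {h : ℂ} (hh : h ≠ 1) :
    h / (h - 1) ∈ negAxis ↔ ∃ r : ℝ, r ≤ 0 ∧ h = r := by
  have h1 : h - 1 ≠ 0 := sub_ne_zero.2 hh
  constructor
  · rintro ⟨s, ⟨hs0, hs1⟩, hs⟩
    refine ⟨s / (s - 1), div_nonpos_of_nonneg_of_nonpos hs0 (by linarith), ?_⟩
    rw [← zCoord_div_sub_one hh, ← hs, zCoord]
    push_cast; rfl
  · rintro ⟨r, hr, rfl⟩
    have : r - 1 < 0 := by linarith
    refine ⟨r / (r - 1), ⟨div_nonneg_of_nonpos hr this.le, ?_⟩, by push_cast; rfl⟩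
    rw [div_le_one_of_neg this]; linarith

section Curve

variable {p q p' q' : Polynomial ℂ}

/-- A coprime parametrization has at most one point above each value of `u₁`. -/
theorem fibre_subsingleton (h : IsCoprime p q) (h' : IsCoprime p' q') (s : ℝ) :
    (fibre (curveIdeal p q p' q') s).Subsingleton := by
  rintro x ⟨hx, hxs⟩ y ⟨hy, hys⟩
  rw [mem_points_curveIdeal] at hx hy
  have n1 := eval_ne_zero_of_coprime h hx.1
  have n2 := eval_ne_zero_of_coprime h' hx.2
  have h0 : x 0 = y 0 := hxs.trans hys.symm
  rw [← h0] at hy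
  ext i
  fin_cases i
  · exact h0
  · exact mul_left_cancel₀ n1 (hx.1.trans hy.1.symm)
  · exact mul_left_cancel₀ n2 (hx.2.trans hy.2.symm)

theorem fibre_curveIdeal {s : ℝ} (h : p.eval (s : ℂ) ≠ 0) (h' : p'.eval (s : ℂ) ≠ 0) :
    fibre (curveIdeal p q p' q') s = {![(s : ℂ), q.eval (s : ℂ) / p.eval (s : ℂ),
      q'.eval (s : ℂ) / p'.eval (s : ℂ)]} := by
  ext x
  rw [fibre, Set.mem_ofPred_eq, mem_points_curveIdeal, Set.mem_singleton_iff]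
  constructor
  · rintro ⟨⟨h1, h2⟩, h0⟩
    rw [h0] at h1 h2
    ext i
    fin_cases i
    · exact h0
    · exact (eq_div_iff h).2 ((mul_comm _ _).trans h1)
    · exact (eq_div_iff h').2 ((mul_comm _ _).trans h2)
  · rintro rfl
    simp [mul_div_cancel₀ _ h, mul_div_cancel₀ _ h']

/-- The derivative of the equation `p(uᵢ) uⱼ = q(uᵢ)` along a vector. -/
theorem sum_pderiv_linForm (x w : Fin 3 → ℂ) (j : Fin 3) (p q : Polynomial ℂ) :
    ∑ i, MvPolynomial.eval x (MvPolynomial.pderiv i (linForm 0 j p q)) * w i =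
      (p.derivative.eval (x 0) * x j - q.derivative.eval (x 0)) * w 0 + p.eval (x 0) * w j := by
  have hev : ∀ r : Polynomial ℂ, MvPolynomial.eval x (Polynomial.aeval (MvPolynomial.X 0) r) =
      r.eval (x 0) := fun r => by
    have := Polynomial.aeval_algHom_apply (MvPolynomial.aeval (R := ℂ) x) (MvPolynomial.X 0) r
    simpa [MvPolynomial.aeval_eq_eval] using this.symm
  have hd : ∀ (i : Fin 3) (r : Polynomial ℂ), MvPolynomial.eval x (MvPolynomial.pderiv i
      (Polynomial.aeval (MvPolynomial.X 0) r)) =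
      r.derivative.eval (x 0) * (Pi.single i 1 : Fin 3 → ℂ) 0 := fun i r => by
    rw [Derivation.map_aeval, smul_eq_mul, map_mul, hev, MvPolynomial.pderiv_X]
    congr 1
    by_cases h : i = 0
    · subst h; simp
    · simp [Pi.single_eq_of_ne (Ne.symm h)]
  have hX : ∀ i : Fin 3, MvPolynomial.eval x (MvPolynomial.pderiv i (MvPolynomial.X j)) =
      (Pi.single i 1 : Fin 3 → ℂ) j := fun i => by
    rw [MvPolynomial.pderiv_X]
    by_cases h : i = j
    · subst h; simp
    · simp [Pi.single_eq_of_ne (Ne.symm h)]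
  have hterm : ∀ i : Fin 3, MvPolynomial.eval x (MvPolynomial.pderiv i (linForm 0 j p q)) * w i =
      (p.derivative.eval (x 0) * x j - q.derivative.eval (x 0)) *
        ((Pi.single i 1 : Fin 3 → ℂ) 0 * w i) +
      p.eval (x 0) * ((Pi.single i 1 : Fin 3 → ℂ) j * w i) := fun i => by
    rw [linForm, map_sub, map_sub, Derivation.leibniz, map_add, smul_eq_mul, smul_eq_mul, map_mul,
      map_mul, hd, hd, hX, hev, MvPolynomial.eval_X]
    ring
  have hs : ∀ k : Fin 3, ∑ i, (Pi.single i 1 : Fin 3 → ℂ) k * w i = w k := fun k => by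
    rw [Finset.sum_eq_single k]
    · simp
    · intro b _ hb
      simp [Pi.single_eq_of_ne (Ne.symm hb)]
    · simp
  rw [Finset.sum_congr rfl fun i _ => hterm i, Finset.sum_add_distrib, ← Finset.mul_sum,
    ← Finset.mul_sum, hs, hs]

theorem tangent_curveIdeal (h : IsCoprime p q) (h' : IsCoprime p' q') {x : Fin 3 → ℂ}
    (hx : x ∈ points (curveIdeal p q p' q')) :
    tangent (curveIdeal p q p' q') x 2 =
      (q'.derivative.eval (x 0) - p'.derivative.eval (x 0) * x 2) / p'.eval (x 0) := by
  obtain ⟨h1, h2⟩ := mem_points_curveIdeal.1 hx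
  have n1 := eval_ne_zero_of_coprime h h1
  have n2 := eval_ne_zero_of_coprime h' h2
  have hex : ∃ w, IsTangent (curveIdeal p q p' q') x w := by
    set w : Fin 3 → ℂ := ![1,
      (q.derivative.eval (x 0) - p.derivative.eval (x 0) * x 1) / p.eval (x 0),
      (q'.derivative.eval (x 0) - p'.derivative.eval (x 0) * x 2) / p'.eval (x 0)] with hw
    refine ⟨w, rfl, fun F hF => ?_⟩
    refine (Submodule.span_induction (p := fun F _ => MvPolynomial.eval x F = 0 ∧
      ∑ i, MvPolynomial.eval x (MvPolynomial.pderiv i F) * w i = 0) ?_ ?_ ?_ ?_ hF).2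
    · rintro F (rfl | rfl)
      · rw [sum_pderiv_linForm, eval_linForm, h1, sub_self]
        refine ⟨rfl, ?_⟩
        simp only [hw, Matrix.cons_val]
        field_simp
        ring
      · rw [sum_pderiv_linForm, eval_linForm, h2, sub_self]
        refine ⟨rfl, ?_⟩
        simp only [hw, Matrix.cons_val]
        field_simp
        ring
    · simp
    · rintro F G _ _ ⟨hF, hF'⟩ ⟨hG, hG'⟩
      refine ⟨by rw [map_add, hF, hG, add_zero], ?_⟩
      simp only [map_add, add_mul, Finset.sum_add_distrib, hF', hG', add_zero]
    · rintro a F _ ⟨hF, hF'⟩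
      refine ⟨by rw [smul_eq_mul, map_mul, hF, mul_zero], ?_⟩
      simp only [smul_eq_mul, Derivation.leibniz, map_add, map_mul, hF, zero_mul, add_zero,
        mul_assoc, ← Finset.mul_sum, hF', mul_zero]
  obtain ⟨h3, h4⟩ : IsTangent (curveIdeal p q p' q') x (tangent (curveIdeal p q p' q') x) :=
    Classical.epsilon_spec hex
  have h5 := h4 _ (linForm_right_mem p q p' q')
  rw [sum_pderiv_linForm, h3, mul_one] at h5
  rw [eq_div_iff n2]
  linear_combination h5

end Curve

/-- The jump of `log z₂` where `z₂ = exp K` crosses the negative real axis: `K` itself is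
continuous, and the principal logarithm differs from it by a constant on each side. -/
theorem logJump_eq {P : Ideal (CubeRing 3)} {x : ℝ → Fin 3 → ℂ} {τ : ℝ}
    (hfib : ∀ᶠ s in 𝓝 τ, fibre P s = {x s}) (hx : ContinuousAt x τ) {K : ℝ → ℂ}
    (hK : ContinuousAt K τ) {c₁ c₂ : ℂ}
    (hl : ∀ᶠ s in 𝓝[<] τ, Complex.log (zCoord (x s 1)) = K s + c₁)
    (hr : ∀ᶠ s in 𝓝[>] τ, Complex.log (zCoord (x s 1)) = K s + c₂) :
    logJump P (x τ) = c₁ - c₂ := by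
  have hτ : (x τ 0).re = τ := by
    have h1 : x τ ∈ fibre P τ := by rw [hfib.self_of_nhds]; rfl
    rw [h1.2, Complex.ofReal_re]
  have hloc : ∀ ε : ℝ, 0 < ε → ∀ᶠ s in 𝓝 τ,
      localLog P (x τ) ε s = Complex.log (zCoord (x s 1)) := by
    intro ε hε
    filter_upwards [hfib, hx.eventually (Metric.ball_mem_nhds (x τ) hε)] with s h1 h2
    replace h2 : x s ∈ Metric.ball (x τ) ε := h2
    rw [localLog, h1, Set.inter_eq_left.2 (Set.singleton_subset_iff.2 h2), finsum_mem_singleton]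
  have hminus : Tendsto (fun δ : ℝ => τ - δ) (𝓝[>] 0) (𝓝[<] τ) := by
    refine tendsto_nhdsWithin_iff.2 ⟨?_, ?_⟩
    · have : Tendsto (fun δ : ℝ => τ - δ) (𝓝 0) (𝓝 (τ - 0)) := by
        exact (continuous_const.sub continuous_id).tendsto 0
      rw [sub_zero] at this
      exact this.mono_left nhdsWithin_le_nhds
    · filter_upwards [self_mem_nhdsWithin] with δ hδ
      simpa using hδ
  have hplus : Tendsto (fun δ : ℝ => τ + δ) (𝓝[>] 0) (𝓝[>] τ) := by
    refine tendsto_nhdsWithin_iff.2 ⟨?_, ?_⟩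
    · have : Tendsto (fun δ : ℝ => τ + δ) (𝓝 0) (𝓝 (τ + 0)) := by
        exact (continuous_const.add continuous_id).tendsto 0
      rw [add_zero] at this
      exact this.mono_left nhdsWithin_le_nhds
    · filter_upwards [self_mem_nhdsWithin] with δ hδ
      simpa using hδ
  have hinner : ∀ ε : ℝ, 0 < ε → Tendsto (fun δ : ℝ =>
      localLog P (x τ) ε ((x τ 0).re - δ) - localLog P (x τ) ε ((x τ 0).re + δ)) (𝓝[>] 0)
      (𝓝 (c₁ - c₂)) := by
    intro ε hε
    have h1 : Tendsto (fun δ : ℝ => K (τ - δ) + c₁ - (K (τ + δ) + c₂)) (𝓝[>] 0)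
        (𝓝 (K τ + c₁ - (K τ + c₂))) :=
      ((hK.tendsto.comp (hminus.mono_right nhdsWithin_le_nhds)).add_const c₁).sub
        ((hK.tendsto.comp (hplus.mono_right nhdsWithin_le_nhds)).add_const c₂)
    rw [add_sub_add_left_eq_sub] at h1
    refine h1.congr' ?_
    filter_upwards [hminus.eventually hl, hplus.eventually hr,
      (hminus.mono_right nhdsWithin_le_nhds).eventually (hloc ε hε),
      (hplus.mono_right nhdsWithin_le_nhds).eventually (hloc ε hε)] with δ e1 e2 e3 e4
    rw [hτ, e3, e4, e1, e2]
  refine Tendsto.limUnder_eq ?_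
  refine tendsto_const_nhds.congr' ?_
  filter_upwards [self_mem_nhdsWithin] with ε hε
  exact (hinner ε hε).limUnder_eq.symm

theorem log_exp_add_int {z : ℂ} (n : ℤ) (h1 : (2 * n - 1) * Real.pi < z.im)
    (h2 : z.im ≤ (2 * n + 1) * Real.pi) :
    Complex.log (Complex.exp z) = z + -(n * (2 * Real.pi * Complex.I)) := by
  have h3 : Complex.exp z = Complex.exp (z + -(n * (2 * Real.pi * Complex.I))) := by
    rw [← sub_eq_add_neg, Complex.exp_periodic.sub_int_mul_eq]
  rw [h3, Complex.log_exp]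
  · simp; linarith
  · simp; linarith

/-- The multiplicity of a point where the argument of `z₂` increases with `u₁` through an odd
multiple of `π` is `-1`, since `T₁` runs in the direction of decreasing `u₁`. -/
theorem crossing_of_strictMono {P : Ideal (CubeRing 3)} {x : ℝ → Fin 3 → ℂ} {τ : ℝ}
    (hfib : ∀ᶠ s in 𝓝 τ, fibre P s = {x s}) (hx : ContinuousAt x τ) {K : ℝ → ℂ}
    (hK : ContinuousAt K τ) (hz : ∀ᶠ s in 𝓝 τ, zCoord (x s 1) = Complex.exp (K s))
    (hmono : StrictMono fun s => (K s).im) {n : ℤ} (hn : (K τ).im = (2 * n + 1) * Real.pi) :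
    crossing P (x τ) = -1 := by
  have him : ContinuousAt (fun s => (K s).im) τ := Complex.continuous_im.continuousAt.comp hK
  have hpi := Real.pi_pos
  have h1 : ∀ᶠ s in 𝓝 τ, (2 * n - 1) * Real.pi < (K s).im :=
    him.eventually_const_lt (by simp only [hn]; nlinarith)
  have h2 : ∀ᶠ s in 𝓝 τ, (K s).im < (2 * n + 3) * Real.pi :=
    him.eventually_lt_const (by simp only [hn]; nlinarith)
  have h3 := logJump_eq hfib hx hK (c₁ := -(n * (2 * Real.pi * Complex.I)))
    (c₂ := -((n + 1 : ℤ) * (2 * Real.pi * Complex.I))) ?_ ?_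
  · rw [crossing, h3, div_eq_iff Complex.two_pi_I_ne_zero]
    push_cast; ring
  · filter_upwards [nhdsWithin_le_nhds hz, nhdsWithin_le_nhds h1, self_mem_nhdsWithin]
      with s e1 e2 e3
    rw [e1, log_exp_add_int n e2 (hn ▸ (hmono e3).le)]
  · filter_upwards [nhdsWithin_le_nhds hz, nhdsWithin_le_nhds h2, self_mem_nhdsWithin]
      with s e1 e2 e3
    have e4 : (K τ).im < (K s).im := hmono e3
    rw [e1, log_exp_add_int (n + 1) (by push_cast; linarith) (by push_cast; linarith)]

/-- The multiplicity of a point where the argument of `z₂` decreases with `u₁` through an odd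
multiple of `π` is `1`. -/
theorem crossing_of_strictAnti {P : Ideal (CubeRing 3)} {x : ℝ → Fin 3 → ℂ} {τ : ℝ}
    (hfib : ∀ᶠ s in 𝓝 τ, fibre P s = {x s}) (hx : ContinuousAt x τ) {K : ℝ → ℂ}
    (hK : ContinuousAt K τ) (hz : ∀ᶠ s in 𝓝 τ, zCoord (x s 1) = Complex.exp (K s))
    (hanti : StrictAnti fun s => (K s).im) {n : ℤ} (hn : (K τ).im = (2 * n + 1) * Real.pi) :
    crossing P (x τ) = 1 := by
  have him : ContinuousAt (fun s => (K s).im) τ := Complex.continuous_im.continuousAt.comp hK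
  have hpi := Real.pi_pos
  have h1 : ∀ᶠ s in 𝓝 τ, (2 * n - 1) * Real.pi < (K s).im :=
    him.eventually_const_lt (by simp only [hn]; nlinarith)
  have h2 : ∀ᶠ s in 𝓝 τ, (K s).im < (2 * n + 3) * Real.pi :=
    him.eventually_lt_const (by simp only [hn]; nlinarith)
  have h3 := logJump_eq hfib hx hK (c₁ := -((n + 1 : ℤ) * (2 * Real.pi * Complex.I)))
    (c₂ := -(n * (2 * Real.pi * Complex.I))) ?_ ?_
  · rw [crossing, h3, div_eq_iff Complex.two_pi_I_ne_zero]
    push_cast; ring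
  · filter_upwards [nhdsWithin_le_nhds hz, nhdsWithin_le_nhds h2, self_mem_nhdsWithin]
      with s e1 e2 e3
    have e4 : (K τ).im < (K s).im := hanti e3
    rw [e1, log_exp_add_int (n + 1) (by push_cast; linarith) (by push_cast; linarith)]
  · filter_upwards [nhdsWithin_le_nhds hz, nhdsWithin_le_nhds h1, self_mem_nhdsWithin]
      with s e1 e2 e3
    rw [e1, log_exp_add_int n e2 (hn ▸ (hanti e3).le)]

/-! ### The argument of the functions along the real chain -/

theorem polyA_re (s : ℝ) : (polyA.eval (s : ℂ)).re = (2 * s - 1) ^ 2 - 1 / 3 := by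
  rw [eval_polyA]
  simp
  ring

theorem polyA_im (s : ℝ) : (polyA.eval (s : ℂ)).im = (2 * s - 1) * ((2 * s - 1) ^ 2 - 1) := by
  rw [eval_polyA]
  simp
  ring

theorem polyC_eq_conj (s : ℝ) : polyC.eval (s : ℂ) = conj (polyA.eval (s : ℂ)) := by
  rw [eval_polyA, eval_polyC]
  simp only [map_add, map_sub, map_mul, map_div₀, map_ofNat, map_one, Complex.conj_I,
    Complex.conj_ofReal]
  ring

theorem normSq_polyA (s : ℝ) :
    Complex.normSq (polyA.eval (s : ℂ)) = ((2 * s - 1) ^ 2 - 1 / 3) ^ 3 + 4 / 27 := by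
  rw [Complex.normSq_apply, polyA_re, polyA_im]
  ring

theorem normSq_polyA_ge (s : ℝ) : 1 / 9 ≤ Complex.normSq (polyA.eval (s : ℂ)) := by
  rw [normSq_polyA]
  have h : 0 ≤ (2 * s - 1) ^ 2 := sq_nonneg _
  set t := (2 * s - 1) ^ 2
  nlinarith [mul_nonneg h (sq_nonneg (t - 1 / 2)), sq_nonneg t]

theorem normSq_polyA_le {s : ℝ} (hs : s ∈ Set.Icc (0 : ℝ) 1) :
    Complex.normSq (polyA.eval (s : ℂ)) ≤ 4 / 9 := by
  rw [normSq_polyA]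
  have h : 0 ≤ (2 * s - 1) ^ 2 := sq_nonneg _
  have h1 : (2 * s - 1) ^ 2 ≤ 1 := by nlinarith [hs.1, hs.2]
  set t := (2 * s - 1) ^ 2
  have h2 : (t - 1 / 3) ^ 3 ≤ (2 / 3 : ℝ) ^ 3 :=
    (Odd.strictMono_pow (by decide : Odd 3)).monotone (by linarith)
  linarith

theorem polyA_ne_zero (s : ℝ) : polyA.eval (s : ℂ) ≠ 0 := fun h => by
  have := normSq_polyA_ge s
  rw [h, map_zero] at this
  norm_num at this

/-- The logarithmic derivative of `a` along the real chain. -/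
def dlogA (s : ℝ) : ℂ := polyA.derivative.eval (s : ℂ) / polyA.eval (s : ℂ)

theorem continuous_dlogA : Continuous dlogA :=
  ((Polynomial.continuous _).comp Complex.continuous_ofReal).div
    ((Polynomial.continuous _).comp Complex.continuous_ofReal) polyA_ne_zero

/-- The argument of `a` increases with `u₁`. -/
theorem dlogA_im_pos (s : ℝ) : 0 < (dlogA s).im := by
  have hre : (polyA.derivative.eval (s : ℂ)).re = 4 * (2 * s - 1) := by
    rw [polyA, eval_derivative_nodalCubic]
    simp [pow_two]
    ring
  have him : (polyA.derivative.eval (s : ℂ)).im = 6 * ((2 * s - 1) ^ 2 - 1 / 3) := by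
    rw [polyA, eval_derivative_nodalCubic]
    simp [pow_two]
    ring
  rw [dlogA, Complex.div_im, ← sub_div, hre, him, polyA_re, polyA_im]
  refine div_pos ?_ (Complex.normSq_pos.2 (polyA_ne_zero s))
  have : 6 * ((2 * s - 1) ^ 2 - 1 / 3) * ((2 * s - 1) ^ 2 - 1 / 3) -
      4 * (2 * s - 1) * ((2 * s - 1) * ((2 * s - 1) ^ 2 - 1)) = 2 * (2 * s - 1) ^ 4 + 2 / 3 := by
    ring
  rw [this]
  positivity

/-- A continuous branch of `log (-a)` along the real chain.  It is real at the midpoint. -/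
def branchA (s : ℝ) : ℂ := -(Real.log 3 : ℂ) + ∫ r in (1 / 2 : ℝ)..s, dlogA r

theorem hasDerivAt_branchA (s : ℝ) : HasDerivAt branchA (dlogA s) s := by
  have := intervalIntegral.integral_hasDerivAt_right
    (continuous_dlogA.intervalIntegrable (1 / 2) s)
    continuous_dlogA.aestronglyMeasurable.stronglyMeasurableAtFilter
    continuous_dlogA.continuousAt
  exact this.const_add _

theorem hasDerivAt_polyA (s : ℝ) :
    HasDerivAt (fun r : ℝ => polyA.eval (r : ℂ)) (polyA.derivative.eval (s : ℂ)) s :=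
  (polyA.hasDerivAt (s : ℂ)).comp_ofReal

theorem exp_branchA (s : ℝ) : Complex.exp (branchA s) = -polyA.eval (s : ℂ) := by
  have hd : ∀ r : ℝ,
      HasDerivAt (fun r : ℝ => polyA.eval (r : ℂ) * Complex.exp (-branchA r)) 0 r := by
    intro r
    have h := (hasDerivAt_polyA r).mul (hasDerivAt_branchA r).neg.cexp
    refine h.congr_deriv ?_
    have e : dlogA r * polyA.eval (r : ℂ) = polyA.derivative.eval (r : ℂ) :=
      div_mul_cancel₀ _ (polyA_ne_zero r)
    rw [← e]
    simp only [Pi.neg_apply]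
    ring
  have hconst := is_const_of_deriv_eq_zero (fun r => (hd r).differentiableAt)
    (fun r => (hd r).deriv) s (1 / 2)
  have hhalf : polyA.eval (((1 / 2 : ℝ) : ℂ)) * Complex.exp (-branchA (1 / 2)) = -1 := by
    rw [branchA, intervalIntegral.integral_same, add_zero, neg_neg, ← Complex.ofReal_exp,
      Real.exp_log (by norm_num), eval_polyA]
    push_cast
    ring
  rw [hhalf] at hconst
  have h := congrArg (fun z => z * Complex.exp (branchA s)) hconst
  simp only [mul_assoc, ← Complex.exp_add, neg_add_cancel, Complex.exp_zero, mul_one] at h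
  rw [h]; ring

theorem hasDerivAt_im {f : ℝ → ℂ} {f' : ℂ} {s : ℝ} (h : HasDerivAt f f' s) :
    HasDerivAt (fun r => (f r).im) f'.im s :=
  Complex.imCLM.hasFDerivAt.comp_hasDerivAt s h

theorem hasDerivAt_re {f : ℝ → ℂ} {f' : ℂ} {s : ℝ} (h : HasDerivAt f f' s) :
    HasDerivAt (fun r => (f r).re) f'.re s :=
  Complex.reCLM.hasFDerivAt.comp_hasDerivAt s h

theorem strictMono_branchA_im : StrictMono fun s => (branchA s).im :=
  strictMono_of_deriv_pos fun s => by
    rw [(hasDerivAt_im (hasDerivAt_branchA s)).deriv]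
    exact dlogA_im_pos s

theorem continuous_branchA : Continuous branchA :=
  continuous_iff_continuousAt.2 fun s => (hasDerivAt_branchA s).continuousAt

theorem continuous_branchA_im : Continuous fun s => (branchA s).im :=
  Complex.continuous_im.comp continuous_branchA

theorem exp_mul_sin_branchA (s : ℝ) : Real.exp (branchA s).re * Real.sin (branchA s).im =
    -((2 * s - 1) * ((2 * s - 1) ^ 2 - 1)) := by
  rw [← Complex.exp_im, exp_branchA, Complex.neg_im, polyA_im]

theorem branchA_im_half : (branchA (1 / 2)).im = 0 := by
  rw [branchA, intervalIntegral.integral_same, add_zero, Complex.neg_im, Complex.ofReal_im,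
    neg_zero]

/-- On the right half of the chain `-a` stays in the upper half plane, so that its argument ends
at `π`. -/
theorem branchA_im_one : (branchA 1).im = Real.pi := by
  have hpos : 0 < (branchA 1).im := by
    rw [← branchA_im_half]
    exact strictMono_branchA_im (by norm_num)
  have hsin : ∀ s : ℝ, 1 / 2 < s → s < 1 → 0 < Real.sin (branchA s).im := by
    intro s h1 h2
    have h := exp_mul_sin_branchA s
    have : 0 < Real.exp (branchA s).re * Real.sin (branchA s).im := by
      rw [h, ← mul_neg]
      exact mul_pos (by linarith) (by nlinarith)
    exact (pos_iff_pos_of_mul_pos this).1 (Real.exp_pos _)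
  have hsin1 : Real.sin (branchA 1).im = 0 := by
    have h := exp_mul_sin_branchA 1
    norm_num at h
    exact h
  have hle : (branchA 1).im ≤ Real.pi := by
    by_contra! hlt
    obtain ⟨c, hc, hcpi⟩ := intermediate_value_Ioo (by norm_num : (1 / 2 : ℝ) ≤ 1)
      continuous_branchA_im.continuousOn
      (show Real.pi ∈ Set.Ioo (branchA (1 / 2)).im (branchA 1).im from
        ⟨by rw [branchA_im_half]; exact Real.pi_pos, hlt⟩)
    have h := hsin c hc.1 hc.2
    simp only at hcpi
    rw [hcpi, Real.sin_pi] at h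
    exact lt_irrefl _ h
  rcases hle.lt_or_eq with h | h
  · exact absurd hsin1 (Real.sin_pos_of_pos_of_lt_pi hpos h).ne'
  · exact h

theorem branchA_im_zero : (branchA 0).im = -Real.pi := by
  have hneg : (branchA 0).im < 0 := by
    have h := strictMono_branchA_im (show (0 : ℝ) < 1 / 2 by norm_num)
    simpa only [branchA_im_half] using h
  have hsin : ∀ s : ℝ, 0 < s → s < 1 / 2 → Real.sin (branchA s).im < 0 := by
    intro s h1 h2
    have h := exp_mul_sin_branchA s
    have : Real.exp (branchA s).re * Real.sin (branchA s).im < 0 := by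
      rw [h, neg_lt_zero]
      exact mul_pos_of_neg_of_neg (by linarith) (by nlinarith)
    exact neg_of_mul_neg_right this (Real.exp_pos _).le
  have hsin0 : Real.sin (branchA 0).im = 0 := by
    have h := exp_mul_sin_branchA 0
    norm_num at h
    exact h
  have hle : -Real.pi ≤ (branchA 0).im := by
    by_contra! hlt
    obtain ⟨c, hc, hcpi⟩ := intermediate_value_Ioo (by norm_num : (0 : ℝ) ≤ 1 / 2)
      continuous_branchA_im.continuousOn
      (show -Real.pi ∈ Set.Ioo (branchA 0).im (branchA (1 / 2)).im from
        ⟨hlt, by rw [branchA_im_half]; exact neg_lt_zero.2 Real.pi_pos⟩)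
    have h := hsin c hc.1 hc.2
    simp only at hcpi
    rw [hcpi, Real.sin_neg, Real.sin_pi, neg_zero] at h
    exact lt_irrefl _ h
  rcases hle.lt_or_eq with h | h
  · exact absurd hsin0 (Real.sin_neg_of_neg_of_neg_pi_lt hneg h).ne
  · exact h.symm

theorem branchA_re (s : ℝ) :
    (branchA s).re = Real.log (Complex.normSq (polyA.eval (s : ℂ))) / 2 := by
  have h : Complex.normSq (polyA.eval (s : ℂ)) = Real.exp (branchA s).re ^ 2 := by
    rw [← Complex.norm_exp, exp_branchA, norm_neg, Complex.normSq_eq_norm_sq]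
  rw [h, Real.log_pow, Real.log_exp]
  push_cast; ring

theorem branchA_re_ge (s : ℝ) : -Real.log 3 ≤ (branchA s).re := by
  rw [branchA_re]
  have := Real.log_le_log (by norm_num) (normSq_polyA_ge s)
  rw [show (1 / 9 : ℝ) = (3 ^ 2)⁻¹ by norm_num, Real.log_inv, Real.log_pow] at this
  push_cast at this
  linarith

theorem branchA_re_le {s : ℝ} (hs : s ∈ Set.Icc (0 : ℝ) 1) :
    (branchA s).re ≤ Real.log 2 - Real.log 3 := by
  rw [branchA_re]
  have := Real.log_le_log (Complex.normSq_pos.2 (polyA_ne_zero s)) (normSq_polyA_le hs)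
  rw [show (4 / 9 : ℝ) = (2 / 3) ^ 2 by norm_num, Real.log_pow,
    Real.log_div (by norm_num) (by norm_num)] at this
  push_cast at this
  linarith

/-- A continuous branch of `log (i a³/8)` along the real chain. -/
def branchF (s : ℝ) : ℂ :=
  3 * branchA s - ((3 * Real.log 2 : ℝ) : ℂ) - (Real.pi / 2 : ℝ) * Complex.I

theorem branchF_re (s : ℝ) : (branchF s).re = 3 * (branchA s).re - 3 * Real.log 2 := by
  simp only [branchF, Complex.sub_re, Complex.re_ofReal_mul, Complex.I_re, Complex.ofReal_re]
  simp

theorem branchF_im (s : ℝ) : (branchF s).im = 3 * (branchA s).im - Real.pi / 2 := by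
  simp only [branchF, Complex.sub_im, Complex.im_ofReal_mul, Complex.I_im, Complex.ofReal_im]
  simp

theorem exp_branchF (s : ℝ) : Complex.exp (branchF s) = (cubePoly polyA).eval (s : ℂ) := by
  have h2 : Real.exp (3 * Real.log 2) = 8 := by
    rw [show 3 * Real.log 2 = Real.log (2 ^ 3) by rw [Real.log_pow]; norm_num,
      Real.exp_log (by norm_num)]
    norm_num
  have h3 : Complex.exp ((Real.pi / 2 : ℝ) * Complex.I) = Complex.I := by
    push_cast
    exact Complex.exp_pi_div_two_mul_I
  rw [branchF, Complex.exp_sub, Complex.exp_sub, h3, ← Complex.ofReal_exp, h2,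
    show 3 * branchA s = ((3 : ℕ) : ℂ) * branchA s by norm_num, Complex.exp_nat_mul, exp_branchA,
    eval_cubePoly, div_eq_iff Complex.I_ne_zero]
  push_cast
  linear_combination -(polyA.eval (s : ℂ)) ^ 3 / 8 * Complex.I_sq

theorem hasDerivAt_branchF (s : ℝ) : HasDerivAt branchF (3 * dlogA s) s :=
  (((hasDerivAt_branchA s).const_mul 3).sub_const _).sub_const _

theorem strictMono_branchF_im : StrictMono fun s => (branchF s).im := fun s t h => by
  have : (branchA s).im < (branchA t).im := strictMono_branchA_im h
  simp only [branchF_im]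
  linarith

theorem continuous_branchF : Continuous branchF :=
  continuous_iff_continuousAt.2 fun s => (hasDerivAt_branchF s).continuousAt

theorem exists_crossings : ∃ σ : Fin 3 → ℝ, ∀ j, σ j ∈ Set.Ioo (0 : ℝ) 1 ∧
    (branchF (σ j)).im = (2 * (((j : ℕ) : ℤ) - 2 : ℤ) + 1) * Real.pi := by
  have h : ∀ j : Fin 3, ∃ c ∈ Set.Ioo (0 : ℝ) 1,
      (branchF c).im = (2 * (((j : ℕ) : ℤ) - 2 : ℤ) + 1) * Real.pi := by
    intro j
    have hpi := Real.pi_pos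
    refine intermediate_value_Ioo (by norm_num : (0 : ℝ) ≤ 1)
      (Complex.continuous_im.comp continuous_branchF).continuousOn ⟨?_, ?_⟩
    · simp only [Function.comp, branchF_im, branchA_im_zero]
      fin_cases j <;> norm_num <;> linarith
    · simp only [Function.comp, branchF_im, branchA_im_one]
      fin_cases j <;> norm_num <;> linarith
  choose σ h1 h2 using h
  exact ⟨σ, fun j => ⟨h1 j, h2 j⟩⟩

/-- The principal logarithm of `i a³/8` differs from the continuous branch by a step function. -/
theorem log_cubePoly_polyA {σ : Fin 3 → ℝ}
    (hσ : ∀ j, (branchF (σ j)).im = (2 * (((j : ℕ) : ℤ) - 2 : ℤ) + 1) * Real.pi) {s : ℝ}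
    (hs : s ∈ Set.Icc (0 : ℝ) 1) :
    Complex.log ((cubePoly polyA).eval (s : ℂ)) = branchF s - 2 * Real.pi * Complex.I +
      ∑ j, {r | r ≤ σ j}.indicator (fun _ => 2 * Real.pi * Complex.I) s := by
  have hpi := Real.pi_pos
  have hmono := strictMono_branchF_im
  have hle : ∀ j, s ≤ σ j ↔ (branchF s).im ≤ (2 * (((j : ℕ) : ℤ) - 2 : ℤ) + 1) * Real.pi :=
    fun j => by rw [← hσ j]; exact hmono.le_iff_le.symm
  have h0 : -(7 / 2) * Real.pi ≤ (branchF s).im := by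
    have : (branchF 0).im ≤ (branchF s).im := hmono.monotone hs.1
    rw [branchF_im 0, branchA_im_zero] at this
    linarith
  have h1 : (branchF s).im ≤ 5 / 2 * Real.pi := by
    have : (branchF s).im ≤ (branchF 1).im := hmono.monotone hs.2
    rw [branchF_im 1, branchA_im_one] at this
    linarith
  rw [← exp_branchF, Fin.sum_univ_three]
  simp only [Set.indicator, Set.mem_ofPred_eq, hle]
  norm_num
  rcases le_or_gt (branchF s).im (-(3 * Real.pi)) with c0 | c0
  · rw [log_exp_add_int (-2) (by push_cast; linarith) (by push_cast; linarith),
      if_pos (by linarith), if_pos (by linarith), if_pos (by linarith)]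
    push_cast; ring
  rcases le_or_gt (branchF s).im (-Real.pi) with c1 | c1
  · rw [log_exp_add_int (-1) (by push_cast; linarith) (by push_cast; linarith),
      if_neg (by linarith), if_pos (by linarith), if_pos (by linarith)]
    push_cast; ring
  rcases le_or_gt (branchF s).im Real.pi with c2 | c2
  · rw [log_exp_add_int 0 (by push_cast; linarith) (by push_cast; linarith),
      if_neg (by linarith), if_neg (by linarith), if_pos (by linarith)]
    push_cast; ring
  · rw [log_exp_add_int 1 (by push_cast; linarith) (by push_cast; linarith),
      if_neg (by linarith), if_neg (by linarith), if_neg (by linarith)]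
    push_cast; ring

/-- Partial integration of `H dH̄`, where the steps of the logarithm are taken into account. -/
theorem im_integral_log_mul_conj {H l : ℝ → ℂ} (hH : ∀ s, HasDerivAt H (l s) s) (hl : Continuous l)
    {n : ℕ} {σ : Fin n → ℝ} (hσ : ∀ j, σ j ∈ Set.Icc (0 : ℝ) 1) (hre : (H 0).re = (H 1).re)
    (him : (H 1).im - (H 0).im = 2 * Real.pi * n) (k : ℝ) :
    (∫ s in (0 : ℝ)..1, (H s - k * Complex.I +
      ∑ j, {r | r ≤ σ j}.indicator (fun _ => 2 * Real.pi * Complex.I) s) * conj (l s)).im =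
      2 * Real.pi * ∑ j, (H (σ j)).re - 2 * ∫ s in (0 : ℝ)..1, (H s).re * (l s).im := by
  have hHc : Continuous H := continuous_iff_continuousAt.2 fun s => (hH s).continuousAt
  have hlc : Continuous fun s => conj (l s) := Complex.continuous_conj.comp hl
  have hint : ∀ a b : ℝ, ∫ s in a..b, conj (l s) = conj (H b) - conj (H a) := by
    intro a b
    refine intervalIntegral.integral_eq_sub_of_hasDerivAt (f := fun s => conj (H s)) (fun s _ => ?_)
      (hlc.intervalIntegrable a b)
    exact Complex.conjCLE.toContinuousLinearMap.hasFDerivAt.comp_hasDerivAt s (hH s)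
  have hind : ∀ (j : Fin n) (s : ℝ), {r | r ≤ σ j}.indicator (fun _ => 2 * Real.pi * Complex.I) s *
      conj (l s) = {r | r ≤ σ j}.indicator (fun s => 2 * Real.pi * Complex.I * conj (l s)) s := by
    intro j s
    by_cases h : s ≤ σ j <;> simp [Set.indicator, h]
  have hii : ∀ j : Fin n, IntervalIntegrable
      ({r | r ≤ σ j}.indicator fun s => 2 * Real.pi * Complex.I * conj (l s))
      MeasureTheory.volume 0 1 := by
    intro j
    have h := (continuous_const (y := (2 * Real.pi * Complex.I : ℂ)).mul hlc).intervalIntegrable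
      (μ := MeasureTheory.volume) 0 1
    rw [intervalIntegrable_iff] at h ⊢
    exact h.indicator measurableSet_Iic
  have hsplit : ∫ s in (0 : ℝ)..1, (H s - k * Complex.I +
      ∑ j, {r | r ≤ σ j}.indicator (fun _ => 2 * Real.pi * Complex.I) s) * conj (l s) =
      (∫ s in (0 : ℝ)..1, H s * conj (l s)) - k * Complex.I * (conj (H 1) - conj (H 0)) +
        ∑ j, 2 * Real.pi * Complex.I * (conj (H (σ j)) - conj (H 0)) := by
    have e : ∀ s, (H s - k * Complex.I +
        ∑ j, {r | r ≤ σ j}.indicator (fun _ => 2 * Real.pi * Complex.I) s) * conj (l s) =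
        H s * conj (l s) - k * Complex.I * conj (l s) +
        ∑ j, {r | r ≤ σ j}.indicator (fun s => 2 * Real.pi * Complex.I * conj (l s)) s := by
      intro s
      rw [add_mul, sub_mul, Finset.sum_mul, Finset.sum_congr rfl fun j _ => hind j s]
    simp_rw [e]
    rw [intervalIntegral.integral_add, intervalIntegral.integral_sub,
      intervalIntegral.integral_finsetSum, intervalIntegral.integral_const_mul, hint]
    · congr 1
      refine Finset.sum_congr rfl fun j _ => ?_
      rw [intervalIntegral.integral_indicator (hσ j), intervalIntegral.integral_const_mul, hint]
    · exact fun j _ => hii j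
    · exact (hHc.mul hlc).intervalIntegrable _ _
    · exact (continuous_const.mul hlc).intervalIntegrable _ _
    · exact ((hHc.mul hlc).sub (continuous_const.mul hlc)).intervalIntegrable _ _
    · simpa only [Finset.sum_fn] using IntervalIntegrable.sum Finset.univ fun j _ => hii j
  have hHre : Continuous fun s => (H s).re := Complex.continuous_re.comp hHc
  have hHim : Continuous fun s => (H s).im := Complex.continuous_im.comp hHc
  have hlre : Continuous fun s => (l s).re := Complex.continuous_re.comp hl
  have hlim : Continuous fun s => (l s).im := Complex.continuous_im.comp hl
  have hparts : (∫ s in (0 : ℝ)..1, H s * conj (l s)).im =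
      (H 1).im * (H 1).re - (H 0).im * (H 0).re - 2 * ∫ s in (0 : ℝ)..1, (H s).re * (l s).im := by
    have h1 : (∫ s in (0 : ℝ)..1, H s * conj (l s)).im =
        ∫ s in (0 : ℝ)..1, (H s * conj (l s)).im :=
      (Complex.imCLM.intervalIntegral_comp_comm
        ((hHc.mul hlc).intervalIntegrable (μ := MeasureTheory.volume) 0 1)).symm
    have h2 := intervalIntegral.integral_eq_sub_of_hasDerivAt (a := 0) (b := 1)
      (fun s _ => (hasDerivAt_im (hH s)).mul (hasDerivAt_re (hH s)))
      (((hlim.mul hHre).add (hHim.mul hlre)).intervalIntegrable 0 1)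
    rw [h1]
    simp only [Pi.mul_apply] at h2
    have h3 := intervalIntegral.integral_sub (μ := MeasureTheory.volume) (a := 0) (b := 1)
      (f := fun s => (l s).im * (H s).re + (H s).im * (l s).re)
      (g := fun s => 2 * ((H s).re * (l s).im))
      (((hlim.mul hHre).add (hHim.mul hlre)).intervalIntegrable 0 1)
      ((continuous_const.mul (hHre.mul hlim)).intervalIntegrable 0 1)
    rw [← h2, ← intervalIntegral.integral_const_mul, ← h3]
    congr 1
    ext s
    simp only [Complex.mul_im, Complex.conj_re, Complex.conj_im]
    ring
  rw [hsplit, Complex.add_im, Complex.sub_im, hparts, Complex.im_sum]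
  have e1 : (k * Complex.I * (conj (H 1) - conj (H 0))).im = 0 := by
    simp [hre]
  have e2 : ∀ j, (2 * Real.pi * Complex.I * (conj (H (σ j)) - conj (H 0))).im =
      2 * Real.pi * (H (σ j)).re - 2 * Real.pi * (H 0).re := by
    intro j; simp; ring
  rw [e1, Finset.sum_congr rfl fun j _ => e2 j, Finset.sum_sub_distrib, ← Finset.mul_sum,
    Finset.sum_const, Finset.card_univ, Fintype.card_fin, nsmul_eq_mul, ← hre]
  linear_combination (H 0).re * him

/-! ### Good position and the regulator of the two curves -/

theorem cubePoly_polyC_eq (s : ℝ) :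
    (cubePoly polyC).eval (s : ℂ) = -conj ((cubePoly polyA).eval (s : ℂ)) := by
  rw [eval_cubePoly, eval_cubePoly, polyC_eq_conj]
  simp [map_ofNat]
  ring

theorem branchF_re_le {s : ℝ} (hs : s ∈ Set.Icc (0 : ℝ) 1) :
    (branchF s).re ≤ -(3 * Real.log 3) := by
  rw [branchF_re]; linarith [branchA_re_le hs]

theorem cubePoly_polyA_ne_one {s : ℝ} (hs : s ∈ Set.Icc (0 : ℝ) 1) :
    (cubePoly polyA).eval (s : ℂ) ≠ 1 := by
  intro h
  have h1 := Complex.norm_exp (branchF s)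
  rw [exp_branchF, h, norm_one] at h1
  have h2 : (branchF s).re < 0 := by
    have := Real.log_pos (show (1 : ℝ) < 3 by norm_num)
    linarith [branchF_re_le hs]
  exact (Real.exp_lt_one_iff.2 h2).ne h1.symm

theorem cubePoly_polyC_ne_one {s : ℝ} (hs : s ∈ Set.Icc (0 : ℝ) 1) :
    (cubePoly polyC).eval (s : ℂ) ≠ 1 := by
  intro h
  have h1 := Complex.norm_exp (branchF s)
  rw [exp_branchF, ← Complex.norm_conj, ← norm_neg, ← cubePoly_polyC_eq, h, norm_one] at h1
  have h2 : (branchF s).re < 0 := by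
    have := Real.log_pos (show (1 : ℝ) < 3 by norm_num)
    linarith [branchF_re_le hs]
  exact (Real.exp_lt_one_iff.2 h2).ne h1.symm

theorem cubePoly_polyA_ne_zero (s : ℝ) : (cubePoly polyA).eval (s : ℂ) ≠ 0 := by
  rw [← exp_branchF]; exact Complex.exp_ne_zero _

theorem cubePoly_polyC_ne_zero (s : ℝ) : (cubePoly polyC).eval (s : ℂ) ≠ 0 := by
  rw [cubePoly_polyC_eq]
  simpa using cubePoly_polyA_ne_zero s

/-- The point of the first curve above a point of `T₁`. -/
def cubePoint (s : ℝ) : Fin 3 → ℂ :=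
  ![(s : ℂ), (cubePoly polyA).eval (s : ℂ) / ((cubePoly polyA).eval (s : ℂ) - 1),
    (cubePoly polyC).eval (s : ℂ) / ((cubePoly polyC).eval (s : ℂ) - 1)]

/-- The point of the second curve above a point of `T₁`. -/
def quotientPoint (s : ℝ) : Fin 3 → ℂ :=
  ![(s : ℂ), polyC.eval (s : ℂ) / (polyC.eval (s : ℂ) - polyA.eval (s : ℂ)), kappa]

theorem fibre_cubeCurve {s : ℝ} (hs : s ∈ Set.Icc (0 : ℝ) 1) :
    fibre cubeCurve s = {cubePoint s} := by
  rw [cubeCurve, fibre_curveIdeal]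
  · simp [cubePoint]
  · simpa [sub_eq_zero] using cubePoly_polyA_ne_one hs
  · simpa [sub_eq_zero] using cubePoly_polyC_ne_one hs

theorem fibre_quotientCurve {s : ℝ} (hs : polyC.eval (s : ℂ) - polyA.eval (s : ℂ) ≠ 0) :
    fibre quotientCurve s = {quotientPoint s} := by
  rw [quotientCurve, fibre_curveIdeal]
  · simp [quotientPoint]
  · simpa using hs
  · simp

/-- On `T₁` the second function is positive where the first one is negative. -/
theorem cubePoly_polyC_of_real {s r : ℝ} (h : (cubePoly polyA).eval (s : ℂ) = r) :
    (cubePoly polyC).eval (s : ℂ) = ((-r : ℝ) : ℂ) := by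
  rw [cubePoly_polyC_eq, h]; simp

theorem eq_cubePoint {x : Fin 3 → ℂ} (hx : x ∈ points cubeCurve) (h0 : x 0 ∈ negAxis) :
    ∃ s ∈ Set.Icc (0 : ℝ) 1, x = cubePoint s := by
  obtain ⟨s, hs, hsx⟩ := h0
  have : x ∈ fibre cubeCurve s := ⟨hx, hsx.symm⟩
  rw [fibre_cubeCurve hs] at this
  exact ⟨s, hs, this⟩

theorem zCoord_cubePoint_one {s : ℝ} (hs : s ∈ Set.Icc (0 : ℝ) 1) :
    zCoord (cubePoint s 1) = (cubePoly polyA).eval (s : ℂ) :=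
  zCoord_div_sub_one (cubePoly_polyA_ne_one hs)

theorem zCoord_cubePoint_two {s : ℝ} (hs : s ∈ Set.Icc (0 : ℝ) 1) :
    zCoord (cubePoint s 2) = (cubePoly polyC).eval (s : ℂ) :=
  zCoord_div_sub_one (cubePoly_polyC_ne_one hs)

theorem exists_im_eq_of_exp_eq_nonpos {z : ℂ} {r : ℝ} (hr : r ≤ 0) (h : Complex.exp z = r) :
    ∃ n : ℤ, z.im = (2 * n + 1) * Real.pi := by
  have hre := congrArg Complex.re h
  have him := congrArg Complex.im h
  rw [Complex.exp_re, Complex.ofReal_re] at hre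
  rw [Complex.exp_im, Complex.ofReal_im] at him
  have hsin : Real.sin z.im = 0 := (mul_eq_zero.1 him).resolve_left (Real.exp_ne_zero _)
  have hcos : Real.cos z.im ≤ 0 := by
    by_contra! hlt
    have := mul_pos (Real.exp_pos z.re) hlt
    linarith
  have hneg : Real.cos z.im = -1 := by
    rcases Real.sin_eq_zero_iff_cos_eq.1 hsin with h1 | h1
    · linarith
    · exact h1
  obtain ⟨n, hn⟩ := Real.cos_eq_neg_one_iff.1 hneg
  exact ⟨n, by linarith⟩

theorem exp_eq_neg_exp_re {z : ℂ} {n : ℤ} (h : z.im = (2 * n + 1) * Real.pi) :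
    Complex.exp z = ((-Real.exp z.re : ℝ) : ℂ) := by
  have hcos : Real.cos z.im = -1 := by
    rw [h, show (2 * n + 1) * Real.pi = n * (2 * Real.pi) + Real.pi by ring]
    exact Real.cos_int_mul_two_pi_add_pi n
  have hsin : Real.sin z.im = 0 := Real.sin_eq_zero_iff_cos_eq.2 (Or.inr hcos)
  apply Complex.ext
  · rw [Complex.exp_re, hcos, Complex.ofReal_re]; ring
  · rw [Complex.exp_im, hsin, Complex.ofReal_im]; ring

theorem crossings_cubeCurve {σ : Fin 3 → ℝ} (hσ : ∀ j, σ j ∈ Set.Ioo (0 : ℝ) 1 ∧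
    (branchF (σ j)).im = (2 * (((j : ℕ) : ℤ) - 2 : ℤ) + 1) * Real.pi) :
    {x | x ∈ points cubeCurve ∧ x 0 ∈ negAxis ∧ x 1 ∈ negAxis} =
      Set.range fun j => cubePoint (σ j) := by
  have hpi := Real.pi_pos
  ext x
  constructor
  · rintro ⟨hx, h0, h1⟩
    obtain ⟨s, hs, rfl⟩ := eq_cubePoint hx h0
    obtain ⟨r, hr, hrs⟩ := (div_sub_one_mem_negAxis (cubePoly_polyA_ne_one hs)).1 h1
    rw [← exp_branchF] at hrs
    obtain ⟨n, hn⟩ := exists_im_eq_of_exp_eq_nonpos hr hrs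
    have hlo : (branchF 0).im ≤ (branchF s).im := strictMono_branchF_im.monotone hs.1
    have hhi : (branchF s).im ≤ (branchF 1).im := strictMono_branchF_im.monotone hs.2
    rw [branchF_im 0, branchA_im_zero, hn] at hlo
    rw [branchF_im 1, branchA_im_one, hn] at hhi
    have h1 : (-3 : ℝ) < n := by
      by_contra! h
      nlinarith
    have h2 : (n : ℝ) < 1 := by
      by_contra! h
      nlinarith
    have h1' : -3 < n := by exact_mod_cast h1
    have h2' : n < 1 := by exact_mod_cast h2
    refine ⟨⟨(n + 2).toNat, by omega⟩, ?_⟩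
    have : (branchF (σ ⟨(n + 2).toNat, by omega⟩)).im = (branchF s).im := by
      rw [(hσ _).2, hn]
      congr 3
      have : ((n + 2).toNat : ℤ) = n + 2 := Int.toNat_of_nonneg (by omega)
      rw [this]
      congr 1
      ring
    exact congrArg cubePoint (strictMono_branchF_im.injective this)
  · rintro ⟨j, rfl⟩
    have hs := Set.Ioo_subset_Icc_self (hσ j).1
    have h1 : cubePoint (σ j) ∈ fibre cubeCurve (σ j) := by rw [fibre_cubeCurve hs]; rfl
    refine ⟨h1.1, ⟨σ j, hs, rfl⟩, (div_sub_one_mem_negAxis (cubePoly_polyA_ne_one hs)).2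
      ⟨-Real.exp (branchF (σ j)).re, (neg_lt_zero.2 (Real.exp_pos _)).le, ?_⟩⟩
    rw [← exp_branchF, exp_eq_neg_exp_re (hσ j).2]

theorem isRealAdmissible_cubeCurve : IsRealAdmissible cubeCurve := by
  have hval : ∀ {s : ℂ}, s = 0 ∨ s = 1 → (cubePoly polyA).eval s = Complex.I / 27 :=
    fun h => cubePoly_eval_facet _ h
  obtain ⟨σ, hσ⟩ := exists_crossings
  refine ⟨fun s _ => ?_, ?_, ?_, ?_, ?_, ?_⟩
  · exact (fibre_subsingleton (isCoprime_sub_one _) (isCoprime_sub_one _) s).finite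
  · rw [crossings_cubeCurve hσ]
    exact Set.finite_range _
  · rintro x hx ⟨h0, h1, h2⟩
    obtain ⟨s, hs, rfl⟩ := eq_cubePoint hx h0
    obtain ⟨r, hr, hrs⟩ := (div_sub_one_mem_negAxis (cubePoly_polyA_ne_one hs)).1 h1
    obtain ⟨t, ht, hts⟩ := (div_sub_one_mem_negAxis (cubePoly_polyC_ne_one hs)).1 h2
    rw [cubePoly_polyC_of_real hrs, Complex.ofReal_inj] at hts
    have : r = 0 := by linarith
    exact cubePoly_polyA_ne_zero s (by rw [hrs, this, Complex.ofReal_zero])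
  · intro x hx h h1
    have h0 : x 0 ∈ negAxis := by
      rcases h with h | h
      · exact ⟨0, by simp, by simp [h]⟩
      · exact ⟨1, by simp, by simp [h]⟩
    obtain ⟨s, hs, rfl⟩ := eq_cubePoint hx h0
    obtain ⟨r, hr, hrs⟩ := (div_sub_one_mem_negAxis (cubePoly_polyA_ne_one hs)).1 h1
    rw [show (cubePoly polyA).eval (s : ℂ) = Complex.I / 27 from hval h] at hrs
    have := congrArg Complex.im hrs
    simp at this
  · intro x hx h h0
    obtain ⟨s, hs, rfl⟩ := eq_cubePoint hx h0
    have h1 := sub_ne_zero.2 (cubePoly_polyA_ne_one hs)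
    rcases h with h | h
    · exact div_ne_zero (cubePoly_polyA_ne_zero s) h1 h
    · exact one_ne_zero (sub_eq_self.1 ((div_eq_one_iff_eq h1).1 h).symm)
  · intro x hx h h0
    obtain ⟨s, hs, rfl⟩ := eq_cubePoint hx h0
    have h1 := sub_ne_zero.2 (cubePoly_polyC_ne_one hs)
    rcases h with h | h
    · exact div_ne_zero (cubePoly_polyC_ne_zero s) h1 h
    · exact one_ne_zero (sub_eq_self.1 ((div_eq_one_iff_eq h1).1 h).symm)

theorem integrand_cubeCurve {s : ℝ} (hs : s ∈ Set.Icc (0 : ℝ) 1) :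
    integrand cubeCurve (cubePoint s) =
      Complex.log ((cubePoly polyA).eval (s : ℂ)) * conj (3 * dlogA s) := by
  have hmem : cubePoint s ∈ points cubeCurve := by
    have : cubePoint s ∈ fibre cubeCurve s := by rw [fibre_cubeCurve hs]; rfl
    exact this.1
  have h1 := sub_ne_zero.2 (cubePoly_polyC_ne_one hs)
  have hA := polyA_ne_zero s
  have hC : polyC.eval (s : ℂ) ≠ 0 := by rw [polyC_eq_conj]; simpa using hA
  have hG := cubePoly_polyC_ne_zero s
  have hd : (cubePoly polyC).derivative.eval (s : ℂ) =
      (cubePoly polyC).eval (s : ℂ) * conj (3 * dlogA s) := by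
    have hconj : polyC.derivative.eval (s : ℂ) = conj (polyA.derivative.eval (s : ℂ)) := by
      rw [polyA, polyC, eval_derivative_nodalCubic, eval_derivative_nodalCubic]
      simp only [map_add, map_sub, map_mul, map_pow, map_ofNat, map_one, Complex.conj_I,
        Complex.conj_ofReal]
    have hdA : conj (3 * dlogA s) = 3 * (polyC.derivative.eval (s : ℂ) / polyC.eval (s : ℂ)) := by
      rw [dlogA, map_mul, map_div₀, hconj, polyC_eq_conj, map_ofNat]
    rw [hdA, eval_cubePoly, cubePoly, Polynomial.derivative_C_mul, Polynomial.derivative_pow]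
    simp
    field_simp
  have ht := tangent_curveIdeal (isCoprime_sub_one _) (isCoprime_sub_one _) hmem
  rw [integrand, zCoord_cubePoint_one hs]
  congr 1
  rw [show tangent cubeCurve (cubePoint s) 2 = _ from ht]
  have e0 : cubePoint s 0 = s := rfl
  have e2 : cubePoint s 2 =
    (cubePoly polyC).eval (s : ℂ) / ((cubePoly polyC).eval (s : ℂ) - 1) := rfl
  rw [e0, e2]
  simp only [Polynomial.derivative_sub, Polynomial.derivative_one, sub_zero, Polynomial.eval_sub,
    Polynomial.eval_one, hd]
  field_simp
  ring

theorem regulator_single (P : Ideal (CubeRing 3)) :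
    regulator (Finsupp.single P 1) = 2 * Real.pi * Complex.I * pointSum P - lineIntegral P := by
  have h := Complex.two_pi_I_ne_zero
  rw [regulator, Finsupp.linearCombination_single, one_smul, currentR]
  field_simp
  ring

theorem lineIntegral_cubeCurve : lineIntegral cubeCurve =
    -∫ s in (0 : ℝ)..1, Complex.log ((cubePoly polyA).eval (s : ℂ)) * conj (3 * dlogA s) := by
  rw [lineIntegral, intervalIntegral.integral_symm]
  congr 1
  refine intervalIntegral.integral_congr fun s hs => ?_
  rw [Set.uIcc_of_le zero_le_one] at hs
  simp only [fibre_cubeCurve hs, finsum_mem_singleton, integrand_cubeCurve hs]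

theorem continuousAt_cubePoint {s : ℝ} (hs : s ∈ Set.Icc (0 : ℝ) 1) : ContinuousAt cubePoint s := by
  have hp : ∀ p : Polynomial ℂ, ContinuousAt (fun s : ℝ => p.eval (s : ℂ)) s := fun p =>
    (p.continuous.comp Complex.continuous_ofReal).continuousAt
  refine continuousAt_pi.2 fun i => ?_
  fin_cases i
  · exact Complex.continuous_ofReal.continuousAt
  · exact (hp _).div ((hp _).sub continuousAt_const) (sub_ne_zero.2 (cubePoly_polyA_ne_one hs))
  · exact (hp _).div ((hp _).sub continuousAt_const) (sub_ne_zero.2 (cubePoly_polyC_ne_one hs))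

theorem crossing_cubeCurve {τ : ℝ} (hτ : τ ∈ Set.Ioo (0 : ℝ) 1) {n : ℤ}
    (hn : (branchF τ).im = (2 * n + 1) * Real.pi) : crossing cubeCurve (cubePoint τ) = -1 := by
  have hnear : ∀ᶠ s in 𝓝 τ, s ∈ Set.Icc (0 : ℝ) 1 := Icc_mem_nhds hτ.1 hτ.2
  refine crossing_of_strictMono (hnear.mono fun s hs => fibre_cubeCurve hs)
    (continuousAt_cubePoint (Set.Ioo_subset_Icc_self hτ)) continuous_branchF.continuousAt
    (hnear.mono fun s hs => ?_) strictMono_branchF_im hn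
  rw [zCoord_cubePoint_one hs, exp_branchF]

theorem pointSum_cubeCurve {σ : Fin 3 → ℝ} (hσ : ∀ j, σ j ∈ Set.Ioo (0 : ℝ) 1 ∧
    (branchF (σ j)).im = (2 * (((j : ℕ) : ℤ) - 2 : ℤ) + 1) * Real.pi) :
    pointSum cubeCurve = -((∑ j, (branchF (σ j)).re : ℝ) : ℂ) := by
  have hinj : Function.Injective fun j => cubePoint (σ j) := by
    intro i j hij
    have h1 : ((σ i : ℝ) : ℂ) = (σ j : ℝ) := congrFun hij 0
    have h2 : (branchF (σ i)).im = (branchF (σ j)).im := by rw [Complex.ofReal_injective h1]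
    rw [(hσ i).2, (hσ j).2] at h2
    have h3 := mul_right_cancel₀ Real.pi_ne_zero h2
    have h4 : 2 * (((i : ℕ) : ℤ) - 2) + 1 = 2 * (((j : ℕ) : ℤ) - 2) + 1 := by exact_mod_cast h3
    ext
    omega
  rw [pointSum, crossings_cubeCurve hσ, finsum_mem_range hinj, finsum_eq_sum_of_fintype]
  push_cast
  rw [← Finset.sum_neg_distrib]
  refine Finset.sum_congr rfl fun j _ => ?_
  rw [crossing_cubeCurve (hσ j).1 (hσ j).2,
    zCoord_cubePoint_two (Set.Ioo_subset_Icc_self (hσ j).1),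
    cubePoly_polyC_of_real ((exp_branchF _).symm.trans (exp_eq_neg_exp_re (hσ j).2)), neg_neg,
    ← Complex.ofReal_log (Real.exp_pos _).le, Real.log_exp]
  ring

/-- The contribution of the crossings cancels against the jumps of the logarithm in the line
integral, and only an integral of `log |a|` against the argument is left. -/
theorem im_regulator_cubeCurve : (regulator (Finsupp.single cubeCurve 1)).im =
    -(2 * ∫ s in (0 : ℝ)..1, (branchF s).re * (3 * dlogA s).im) := by
  obtain ⟨σ, hσ⟩ := exists_crossings
  have hre : (branchF 0).re = (branchF 1).re := by
    rw [branchF_re, branchF_re, branchA_re, branchA_re, normSq_polyA, normSq_polyA]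
    norm_num
  have h1 := im_integral_log_mul_conj hasDerivAt_branchF (continuous_const.mul continuous_dlogA)
    (fun j => Set.Ioo_subset_Icc_self (hσ j).1) hre
    (by rw [branchF_im, branchF_im, branchA_im_zero, branchA_im_one]; push_cast; ring)
    (2 * Real.pi)
  have h2 : ∫ s in (0 : ℝ)..1, Complex.log ((cubePoly polyA).eval (s : ℂ)) * conj (3 * dlogA s) =
      ∫ s in (0 : ℝ)..1, (branchF s - (2 * Real.pi : ℝ) * Complex.I +
        ∑ j, {r | r ≤ σ j}.indicator (fun _ => 2 * Real.pi * Complex.I) s) *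
          conj (3 * dlogA s) := by
    refine intervalIntegral.integral_congr fun s hs => ?_
    rw [Set.uIcc_of_le zero_le_one] at hs
    simp only [log_cubePoly_polyA (fun j => (hσ j).2) hs]
    push_cast
    rfl
  rw [← h2] at h1
  rw [regulator_single, pointSum_cubeCurve hσ, lineIntegral_cubeCurve, sub_neg_eq_add,
    Complex.add_im, h1]
  have h3 : (2 * Real.pi * Complex.I * -((∑ j, (branchF (σ j)).re : ℝ) : ℂ)).im =
      -(2 * Real.pi * ∑ j, (branchF (σ j)).re) := by
    rw [show (2 * Real.pi * Complex.I * -((∑ j, (branchF (σ j)).re : ℝ) : ℂ)) =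
      ((-(2 * Real.pi * ∑ j, (branchF (σ j)).re) : ℝ) : ℂ) * Complex.I by push_cast; ring]
    rw [Complex.im_ofReal_mul, Complex.I_im, mul_one]
  rw [h3]
  ring

theorem integral_branchF_bounds :
    -(18 * Real.pi * (Real.log 2 + Real.log 3)) ≤
      ∫ s in (0 : ℝ)..1, (branchF s).re * (3 * dlogA s).im ∧
    ∫ s in (0 : ℝ)..1, (branchF s).re * (3 * dlogA s).im ≤ -(18 * Real.pi * Real.log 3) := by
  have hlim : Continuous fun s => (3 * dlogA s).im :=
    Complex.continuous_im.comp (continuous_const.mul continuous_dlogA)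
  have hHre : Continuous fun s => (branchF s).re := Complex.continuous_re.comp continuous_branchF
  have hint : ∫ s in (0 : ℝ)..1, (3 * dlogA s).im = 6 * Real.pi := by
    rw [intervalIntegral.integral_eq_sub_of_hasDerivAt
      (fun s _ => hasDerivAt_im (hasDerivAt_branchF s)) (hlim.intervalIntegrable 0 1),
      branchF_im, branchF_im, branchA_im_zero, branchA_im_one]
    ring
  have hpos : ∀ s, 0 ≤ (3 * dlogA s).im := fun s => by
    have := dlogA_im_pos s
    simp
    linarith
  have hi := (hHre.mul hlim).intervalIntegrable (μ := MeasureTheory.volume) 0 1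
  have hc : ∀ c : ℝ, IntervalIntegrable (fun s => c * (3 * dlogA s).im) MeasureTheory.volume 0 1 :=
    fun c => (continuous_const.mul hlim).intervalIntegrable 0 1
  constructor
  · have := intervalIntegral.integral_mono_on zero_le_one (hc (-(3 * (Real.log 2 + Real.log 3)))) hi
      (fun s _ => mul_le_mul_of_nonneg_right
        (by simp only [branchF_re]; linarith [branchA_re_ge s]) (hpos s))
    rw [intervalIntegral.integral_const_mul, hint] at this
    refine le_trans (le_of_eq ?_) this
    ring
  · have := intervalIntegral.integral_mono_on zero_le_one hi (hc (-(3 * Real.log 3)))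
      (fun s hs => mul_le_mul_of_nonneg_right (branchF_re_le hs) (hpos s))
    rw [intervalIntegral.integral_const_mul, hint] at this
    refine le_trans this (le_of_eq ?_)
    ring

/-! ### The second curve -/

/-- A continuous branch of `log (c/a)` along the real chain. -/
def branchQ (s : ℝ) : ℂ := conj (branchA s) - branchA s

theorem branchQ_im (s : ℝ) : (branchQ s).im = -2 * (branchA s).im := by
  simp [branchQ]; ring

theorem branchQ_re (s : ℝ) : (branchQ s).re = 0 := by simp [branchQ]

theorem exp_branchQ (s : ℝ) :
    Complex.exp (branchQ s) = polyC.eval (s : ℂ) / polyA.eval (s : ℂ) := by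
  rw [branchQ, Complex.exp_sub, Complex.exp_conj, exp_branchA, map_neg, polyC_eq_conj,
    neg_div_neg_eq]

theorem continuous_branchQ : Continuous branchQ :=
  (Complex.continuous_conj.comp continuous_branchA).sub continuous_branchA

theorem quotientPoint_one (s : ℝ) : quotientPoint s 1 =
    polyC.eval (s : ℂ) / polyA.eval (s : ℂ) / (polyC.eval (s : ℂ) / polyA.eval (s : ℂ) - 1) := by
  have hA := polyA_ne_zero s
  rw [div_sub_one hA, div_div_div_cancel_right₀ hA]
  rfl

theorem div_ne_one_of_sub_ne_zero {s : ℝ} (hs : polyC.eval (s : ℂ) - polyA.eval (s : ℂ) ≠ 0) :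
    polyC.eval (s : ℂ) / polyA.eval (s : ℂ) ≠ 1 := fun h =>
  hs (sub_eq_zero.2 ((div_eq_one_iff_eq (polyA_ne_zero s)).1 h))

theorem sub_ne_zero_of_mem_points {x : Fin 3 → ℂ} (hx : x ∈ points quotientCurve) :
    polyC.eval (x 0) - polyA.eval (x 0) ≠ 0 := by
  have := eval_ne_zero_of_coprime isCoprime_sub_polyC (mem_points_curveIdeal.1 hx).1
  simpa using this

theorem eq_quotientPoint {x : Fin 3 → ℂ} (hx : x ∈ points quotientCurve) (h0 : x 0 ∈ negAxis) :
    ∃ s ∈ Set.Icc (0 : ℝ) 1, polyC.eval (s : ℂ) - polyA.eval (s : ℂ) ≠ 0 ∧ x = quotientPoint s := by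
  obtain ⟨s, hs, hsx⟩ := h0
  have h1 := sub_ne_zero_of_mem_points hx
  rw [← hsx] at h1
  have : x ∈ fibre quotientCurve s := ⟨hx, hsx.symm⟩
  rw [fibre_quotientCurve h1] at this
  exact ⟨s, hs, h1, this⟩

theorem exists_crossings_quotient : ∃ τ : Fin 2 → ℝ, ∀ j, τ j ∈ Set.Ioo (0 : ℝ) 1 ∧
    (branchQ (τ j)).im = (2 * (((j : ℕ) : ℤ) - 1 : ℤ) + 1) * Real.pi := by
  have h : ∀ j : Fin 2, ∃ c ∈ Set.Ioo (0 : ℝ) 1,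
      (branchQ c).im = (2 * (((j : ℕ) : ℤ) - 1 : ℤ) + 1) * Real.pi := by
    intro j
    have hpi := Real.pi_pos
    refine intermediate_value_Ioo' (by norm_num : (0 : ℝ) ≤ 1)
      (Complex.continuous_im.comp continuous_branchQ).continuousOn ⟨?_, ?_⟩
    · simp only [Function.comp, branchQ_im, branchA_im_one]
      fin_cases j <;> norm_num <;> linarith
    · simp only [Function.comp, branchQ_im, branchA_im_zero]
      fin_cases j <;> norm_num <;> linarith
  choose τ h1 h2 using h
  exact ⟨τ, fun j => ⟨h1 j, h2 j⟩⟩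

theorem sub_ne_zero_of_crossing {s : ℝ} {n : ℤ} (h : (branchQ s).im = (2 * n + 1) * Real.pi) :
    polyC.eval (s : ℂ) - polyA.eval (s : ℂ) ≠ 0 := by
  intro h0
  have h1 := exp_eq_neg_exp_re h
  rw [exp_branchQ, (div_eq_one_iff_eq (polyA_ne_zero s)).2 (sub_eq_zero.1 h0), branchQ_re,
    Real.exp_zero] at h1
  norm_num at h1

theorem crossings_quotientCurve {τ : Fin 2 → ℝ} (hτ : ∀ j, τ j ∈ Set.Ioo (0 : ℝ) 1 ∧
    (branchQ (τ j)).im = (2 * (((j : ℕ) : ℤ) - 1 : ℤ) + 1) * Real.pi) :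
    {x | x ∈ points quotientCurve ∧ x 0 ∈ negAxis ∧ x 1 ∈ negAxis} =
      Set.range fun j => quotientPoint (τ j) := by
  have hpi := Real.pi_pos
  ext x
  constructor
  · rintro ⟨hx, h0, h1⟩
    obtain ⟨s, hs, hne, rfl⟩ := eq_quotientPoint hx h0
    rw [quotientPoint_one] at h1
    obtain ⟨r, hr, hrs⟩ := (div_sub_one_mem_negAxis (div_ne_one_of_sub_ne_zero hne)).1 h1
    rw [← exp_branchQ] at hrs
    obtain ⟨n, hn⟩ := exists_im_eq_of_exp_eq_nonpos hr hrs
    have hlo : (branchA 0).im ≤ (branchA s).im := strictMono_branchA_im.monotone hs.1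
    have hhi : (branchA s).im ≤ (branchA 1).im := strictMono_branchA_im.monotone hs.2
    rw [branchA_im_zero] at hlo
    rw [branchA_im_one] at hhi
    have hn' := hn
    rw [branchQ_im] at hn'
    have h1 : (-2 : ℝ) < n := by
      by_contra! h
      nlinarith
    have h2 : (n : ℝ) < 1 := by
      by_contra! h
      nlinarith
    have h1' : -2 < n := by exact_mod_cast h1
    have h2' : n < 1 := by exact_mod_cast h2
    refine ⟨⟨(n + 1).toNat, by omega⟩, ?_⟩
    have : (branchQ (τ ⟨(n + 1).toNat, by omega⟩)).im = (branchQ s).im := by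
      rw [(hτ _).2, hn]
      congr 3
      have : ((n + 1).toNat : ℤ) = n + 1 := Int.toNat_of_nonneg (by omega)
      rw [this]
      congr 1
      ring
    rw [branchQ_im, branchQ_im] at this
    exact congrArg quotientPoint (strictMono_branchA_im.injective
      (mul_left_cancel₀ (by norm_num : (-2 : ℝ) ≠ 0) this))
  · rintro ⟨j, rfl⟩
    have hs := Set.Ioo_subset_Icc_self (hτ j).1
    have hne := sub_ne_zero_of_crossing (hτ j).2
    have h1 : quotientPoint (τ j) ∈ fibre quotientCurve (τ j) := by
      rw [fibre_quotientCurve hne]; rfl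
    refine ⟨h1.1, ⟨τ j, hs, rfl⟩, ?_⟩
    change quotientPoint (τ j) 1 ∈ negAxis
    rw [quotientPoint_one]
    refine (div_sub_one_mem_negAxis (div_ne_one_of_sub_ne_zero hne)).2
      ⟨-Real.exp (branchQ (τ j)).re, (neg_lt_zero.2 (Real.exp_pos _)).le, ?_⟩
    rw [← exp_branchQ, exp_eq_neg_exp_re (hτ j).2]

theorem zCoord_kappa : zCoord kappa = kConst := zCoord_div_sub_one kConst_ne_one

theorem isRealAdmissible_quotientCurve : IsRealAdmissible quotientCurve := by
  obtain ⟨τ, hτ⟩ := exists_crossings_quotient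
  refine ⟨fun s _ => ?_, ?_, ?_, ?_, ?_, ?_⟩
  · exact (fibre_subsingleton isCoprime_sub_polyC isCoprime_one_left s).finite
  · rw [crossings_quotientCurve hτ]
    exact Set.finite_range _
  · rintro x hx ⟨_, _, h2⟩
    rw [(mem_points_quotientCurve.1 hx).2] at h2
    obtain ⟨r, _, hr⟩ := (div_sub_one_mem_negAxis kConst_ne_one).1 h2
    have := congrArg Complex.im hr
    rw [kConst_im, Complex.ofReal_im] at this
    norm_num at this
  · intro x hx h _
    have h1 := sub_ne_zero_of_mem_points hx
    rw [eval_polyA, eval_polyC] at h1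
    refine h1 ?_
    rcases h with h | h <;> rw [h] <;> ring
  · intro x hx h h0
    obtain ⟨s, _, hne, rfl⟩ := eq_quotientPoint hx h0
    have h1 := sub_ne_zero.2 (div_ne_one_of_sub_ne_zero hne)
    rw [quotientPoint_one] at h
    have h2 : polyC.eval (s : ℂ) / polyA.eval (s : ℂ) ≠ 0 := by
      rw [← exp_branchQ]; exact Complex.exp_ne_zero _
    rcases h with h | h
    · exact div_ne_zero h2 h1 h
    · exact one_ne_zero (sub_eq_self.1 ((div_eq_one_iff_eq h1).1 h).symm)
  · intro x hx h
    rw [(mem_points_quotientCurve.1 hx).2] at h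
    rcases h with h | h
    · exact absurd h kappa_ne_zero
    · exact absurd h kappa_ne_one

theorem lineIntegral_quotientCurve : lineIntegral quotientCurve = 0 := by
  have h : ∀ s, ∑ᶠ x ∈ fibre quotientCurve s, integrand quotientCurve x = 0 := by
    intro s
    refine finsum_mem_of_eqOn_zero fun x hx => ?_
    have ht := tangent_curveIdeal isCoprime_sub_polyC isCoprime_one_left hx.1
    rw [integrand, show tangent quotientCurve x 2 = _ from ht]
    simp
  simp [lineIntegral, h]

theorem crossing_quotientCurve {τ : ℝ} {n : ℤ}
    (hn : (branchQ τ).im = (2 * n + 1) * Real.pi) :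
    crossing quotientCurve (quotientPoint τ) = 1 := by
  have hp : ∀ p : Polynomial ℂ, ContinuousAt (fun s : ℝ => p.eval (s : ℂ)) τ := fun p =>
    (p.continuous.comp Complex.continuous_ofReal).continuousAt
  have hne := sub_ne_zero_of_crossing hn
  have hnear : ∀ᶠ s : ℝ in 𝓝 τ, polyC.eval (s : ℂ) - polyA.eval (s : ℂ) ≠ 0 :=
    ((hp _).sub (hp _)).eventually_ne hne
  have hcont : ContinuousAt quotientPoint τ := by
    refine continuousAt_pi.2 fun i => ?_
    fin_cases i
    · exact Complex.continuous_ofReal.continuousAt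
    · exact (hp _).div ((hp _).sub (hp _)) hne
    · exact continuousAt_const
  refine crossing_of_strictAnti (hnear.mono fun s hs => fibre_quotientCurve hs) hcont
    continuous_branchQ.continuousAt (hnear.mono fun s hs => ?_) (fun s t hst => ?_) hn
  · rw [quotientPoint_one, zCoord_div_sub_one (div_ne_one_of_sub_ne_zero hs), exp_branchQ]
  · have : (branchA s).im < (branchA t).im := strictMono_branchA_im hst
    simp only [branchQ_im]
    linarith

theorem pointSum_quotientCurve : pointSum quotientCurve = 2 * Complex.log kConst := by
  obtain ⟨τ, hτ⟩ := exists_crossings_quotient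
  have hinj : Function.Injective fun j => quotientPoint (τ j) := by
    intro i j hij
    have h1 : ((τ i : ℝ) : ℂ) = (τ j : ℝ) := congrFun hij 0
    have h2 : (branchQ (τ i)).im = (branchQ (τ j)).im := by rw [Complex.ofReal_injective h1]
    rw [(hτ i).2, (hτ j).2] at h2
    have h3 := mul_right_cancel₀ Real.pi_ne_zero h2
    have h4 : 2 * (((i : ℕ) : ℤ) - 1) + 1 = 2 * (((j : ℕ) : ℤ) - 1) + 1 := by exact_mod_cast h3
    ext
    omega
  rw [pointSum, crossings_quotientCurve hτ, finsum_mem_range hinj, finsum_eq_sum_of_fintype]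
  have : ∀ j, crossing quotientCurve (quotientPoint (τ j)) *
      Complex.log (zCoord (quotientPoint (τ j) 2)) = Complex.log kConst := by
    intro j
    rw [crossing_quotientCurve (hτ j).2, one_mul]
    exact congrArg Complex.log zCoord_kappa
  simp [this]

theorem im_regulator_quotientCurve : (regulator (Finsupp.single quotientCurve 1)).im =
    4 * Real.pi * (2 * Real.log 2 - 3 * Real.log 3) := by
  have hnorm : ‖kConst‖ = 2 ^ 2 / 3 ^ 3 := by
    rw [kConst]; norm_num
  rw [regulator_single, lineIntegral_quotientCurve, pointSum_quotientCurve, sub_zero,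
    show 2 * Real.pi * Complex.I * (2 * Complex.log kConst) =
      ((4 * Real.pi : ℝ) : ℂ) * (Complex.I * Complex.log kConst) by push_cast; ring,
    Complex.im_ofReal_mul, Complex.I_mul_im, Complex.log_re, hnorm,
    Real.log_div (by norm_num) (by norm_num), Real.log_pow, Real.log_pow]
  push_cast; ring

/-! ### The Abel–Jacobi class -/

theorem im_regulator_nodalCycle_bounds :
    24 * Real.pi * Real.log 2 ≤ (regulator nodalCycle).im ∧
      (regulator nodalCycle).im ≤ 60 * Real.pi * Real.log 2 := by
  have h : (regulator nodalCycle).im = (regulator (Finsupp.single cubeCurve 1)).im +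
      3 * (regulator (Finsupp.single quotientCurve 1)).im := by
    rw [nodalCycle_eq, map_add, map_smul, Complex.add_im, Complex.smul_im, Rat.smul_def]
    norm_num
  rw [h, im_regulator_cubeCurve, im_regulator_quotientCurve]
  obtain ⟨h1, h2⟩ := integral_branchF_bounds
  constructor <;> linarith

theorem nodalCycle_mem_realClosedCycles : nodalCycle ∈ realClosedCycles := by
  refine ⟨nodalCycle_mem_closedCycles, ?_⟩
  rw [nodalCycle_eq]
  refine add_mem ?_ (Submodule.smul_mem _ _ ?_)
  · exact Finsupp.single_mem_supported ℚ _ isRealAdmissible_cubeCurve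
  · exact Finsupp.single_mem_supported ℚ _ isRealAdmissible_quotientCurve

/-- The subgroup `ℚ(2)` consists of real numbers. -/
theorem im_eq_zero_of_mem_rationalTwist {z : ℂ} (hz : z ∈ rationalTwist) : z.im = 0 := by
  rw [rationalTwist_eq] at hz
  obtain ⟨r, rfl⟩ := Submodule.mem_span_singleton.1 hz
  rw [Complex.smul_im, ← Complex.ofReal_pow, Complex.ofReal_im, smul_zero]

end NodalRegulator

end

theorem theorem2p4 :
    NodalRegulator.symbolSum NodalRegulator.nodalPairs =
        NodalRegulator.Symbols.map NodalRegulator.restrictNodal NodalRegulator.xiTwo ∧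
      NodalRegulator.rationalTwist = Submodule.span ℚ {(Real.pi : ℂ) ^ 2} ∧
      ∃ hZ : NodalRegulator.nodalCycle ∈ NodalRegulator.realClosedCycles,
        24 * Real.pi * Real.log 2 ≤ (NodalRegulator.regulator NodalRegulator.nodalCycle).im ∧
        (NodalRegulator.regulator NodalRegulator.nodalCycle).im ≤ 60 * Real.pi * Real.log 2 ∧
        ((NodalRegulator.chowClass ⟨NodalRegulator.nodalCycle, hZ⟩,
          NodalRegulator.rationalTwist.mkQ (NodalRegulator.regulator NodalRegulator.nodalCycle)) ∈
            NodalRegulator.abelJacobiGraph) ∧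
        NodalRegulator.rationalTwist.mkQ (NodalRegulator.regulator NodalRegulator.nodalCycle) ≠ 0 :=
  by
  obtain ⟨h1, h2⟩ := NodalRegulator.im_regulator_nodalCycle_bounds
  refine ⟨NodalRegulator.symbolSum_nodalPairs, NodalRegulator.rationalTwist_eq,
    NodalRegulator.nodalCycle_mem_realClosedCycles, h1, h2,
    ⟨⟨NodalRegulator.nodalCycle, NodalRegulator.nodalCycle_mem_realClosedCycles⟩, rfl⟩, ?_⟩
  intro h
  have h3 := NodalRegulator.im_eq_zero_of_mem_rationalTwist ((Submodule.Quotient.mk_eq_zero _).1 h)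
  have h4 := mul_pos (mul_pos (by norm_num : (0 : ℝ) < 24) Real.pi_pos)
    (Real.log_pos (by norm_num : (1 : ℝ) < 2))
  linarith
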